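/- **Theorem 4.2 (Computable moments).** Let $\vec x=(x_i)_{i\in\omega}$ be a random vector in $[0,1]^\omega$ with distribution $\eta$. The *representation* of $\eta$ is the set of all pairs $(B,q)$ with $\eta(B)>q$, where $q\in\mathbf{Q}$ and $B$ is a finite union of cylinders $\{y\in[0,1]^\omega : y_i\in\sigma(i) \text{ for } i<k\}$ whose $\sigma(0),\dots,\sigma(k-1)$ are open intervals with rational endpoints. The *mixed moments* of $\{x_i\}_{i\in\omega}$ are the reals $m_\beta=\mathbb{E}\bigl(\prod_{j=1}^k x_{\beta(j)}\bigr)$ for finite sequences $\beta$ of elements of $\omega$ (repetitions allowed), and their *representation* is the set of all pairs $(\beta,I)$ with $m_\beta\in I$, where $I$ is an open interval with rational endpoints. Under standard codings of these finite objects, both representations are regarded as subsets of $\omega$. The distribution $\eta$ is *computable*, respectively the mixed moments are *uniformly computable*, when the representation is computably enumerable. Then $\eta$ is uniformly computable in the mixed moments of $\{x_i\}_{i\in\omega}$, and vice versa. That is: 1. there is a single oracle program which, for every random vector $\vec x$ in $[0,1]^\omega$, given any enumeration of the representation of the mixed moments as an oracle, enumerates the representation of $\eta$; 2. there is a single oracle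 program which, for every random vector $\vec x$ in $[0,1]^\omega$, given any enumeration of the representation of $\eta$ as an oracle, enumerates the representation of the mixed moments. In particular, $\eta$ is computable if and only if the mixed moments of $\{x_i\}_{i\in\omega}$ are uniformly computable. -/

import Mathlib

open MeasureTheory ProbabilityTheory

universe u

/-! ### Oracle programs -/

/-- Programs for oracle computation on `ℕ`: the codes of partial recursive functions, with one
additional instruction that queries the oracle. -/
inductive OracleCode : Type
  | zero : OracleCode
  | succ : OracleCode
  | left : OracleCode
  | right : OracleCode
  | oracle : OracleCode
  | pair : OracleCode → OracleCode → OracleCode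
  | comp : OracleCode → OracleCode → OracleCode
  | prec : OracleCode → OracleCode → OracleCode
  | rfind : OracleCode → OracleCode

namespace OracleCode

/-- The partial function computed by a program when it runs with the oracle `p : ℕ → ℕ`. The
program is fixed; only the answers to its queries depend on `p`. -/
def eval (p : ℕ → ℕ) : OracleCode → ℕ →. ℕ
  | zero => fun _ => Part.some 0
  | succ => fun n => Part.some (n + 1)
  | left => fun n => Part.some n.unpair.1
  | right => fun n => Part.some n.unpair.2
  | oracle => fun n => Part.some (p n)
  | pair cf cg => fun n => Nat.pair <$> eval p cf n <*> eval p cg n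
  | comp cf cg => fun n => eval p cg n >>= eval p cf
  | prec cf cg => fun m =>
      let (a, n) := Nat.unpair m
      n.rec (eval p cf a) fun y IH => do
        let i ← IH
        eval p cg (Nat.pair a (Nat.pair y i))
  | rfind cf => fun a => Nat.rfind fun n => (fun m => m = 0) <$> eval p cf (Nat.pair a n)

/-- Relative to a fixed oracle, the programs compute exactly the partial functions that are
recursive in that oracle. -/
theorem exists_eval_eq_iff (p : ℕ → ℕ) (f : ℕ →. ℕ) :
    (∃ c : OracleCode, c.eval p = f) ↔ Nat.RecursiveIn {(p : ℕ →. ℕ)} f := by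
  constructor
  · rintro ⟨c, rfl⟩
    induction c with
    | zero => exact .zero
    | succ => exact .succ
    | left => exact .left
    | right => exact .right
    | oracle => exact .oracle _ rfl
    | pair _ _ hf hg => exact .pair hf hg
    | comp _ _ hf hg => exact .comp hf hg
    | prec _ _ hf hg => exact .prec hf hg
    | rfind _ hf => exact .rfind hf
  · intro h
    induction h with
    | zero => exact ⟨zero, rfl⟩
    | succ => exact ⟨succ, rfl⟩
    | left => exact ⟨left, rfl⟩
    | right => exact ⟨right, rfl⟩
    | oracle g hg => obtain rfl : g = p := hg; exact ⟨oracle, rfl⟩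
    | pair _ _ hf hg =>
      obtain ⟨cf, rfl⟩ := hf; obtain ⟨cg, rfl⟩ := hg; exact ⟨pair cf cg, rfl⟩
    | comp _ _ hf hg =>
      obtain ⟨cf, rfl⟩ := hf; obtain ⟨cg, rfl⟩ := hg; exact ⟨comp cf cg, rfl⟩
    | prec _ _ hf hg =>
      obtain ⟨cf, rfl⟩ := hf; obtain ⟨cg, rfl⟩ := hg; exact ⟨prec cf cg, rfl⟩
    | rfind _ hf => obtain ⟨cf, rfl⟩ := hf; exact ⟨rfind cf, rfl⟩

end OracleCode

/-- `p` lists (the codes of) the elements of `A`, in any order and with any repetitions: `A` is the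
set of all `a` such that the code of `a` plus one is a value of `p`, and every nonzero value of `p`
is of this form. The value `0` means that nothing is listed, so that `A` may be empty. In
particular `p n = n + 1` for `n` a code of an element of `A` and `p n = 0` otherwise, i.e. the set
`A` itself given as a membership oracle, is such a listing. -/
def IsListing {α : Type*} [Primcodable α] (p : ℕ → ℕ) (A : Set α) : Prop :=
  ∀ m : ℕ, (∃ n, p n = m + 1) ↔ ∃ a ∈ A, Encodable.encode a = m

/-- The program `c` computes the representation `A` from the representation `B`: with any listing
of `B` as its oracle, `c` halts exactly on the codes of the elements of `A` (that is, it
enumerates `A`). -/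
def OracleCode.ComputesFrom {α β : Type*} [Primcodable α] [Primcodable β]
    (c : OracleCode) (A : Set α) (B : Set β) : Prop :=
  ∀ p : ℕ → ℕ, IsListing p B →
    ∀ m : ℕ, (c.eval p m).Dom ↔ ∃ a ∈ A, Encodable.encode a = m

/-! ### Indices for rationals, intervals, cylinders and their finite unions -/

/-- Indices for rational numbers. -/
abbrev RatIndex : Type := (ℕ × ℕ) × ℕ

/-- The index `((a, b), c)` denotes the rational number `(a - b) / (c + 1)`. -/
def RatIndex.val (r : RatIndex) : ℚ := ((r.1.1 : ℚ) - (r.1.2 : ℚ)) / ((r.2 : ℚ) + 1)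

theorem RatIndex.val_surjective : Function.Surjective RatIndex.val := by
  intro q
  refine ⟨((q.num.toNat, (-q.num).toNat), q.den - 1), ?_⟩
  have h1 : ((q.num.toNat : ℤ) : ℚ) - (((-q.num).toNat : ℤ) : ℚ) = (q.num : ℚ) := by
    rw [← Int.cast_sub]; congr 1; omega
  have h2 : ((q.den - 1 : ℕ) : ℚ) + 1 = q.den := by
    rw [Nat.cast_sub q.pos]; simp
  simp only [RatIndex.val]
  rw [h2]
  simp only [Int.cast_natCast] at h1
  rw [h1, Rat.num_div_den]

/-- Indices for open intervals with rational endpoints. -/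
abbrev IntervalIndex : Type := RatIndex × RatIndex

/-- The open interval denoted by an index. -/
def IntervalIndex.toSet (I : IntervalIndex) : Set ℝ :=
  Set.Ioo ((RatIndex.val I.1 : ℚ) : ℝ) ((RatIndex.val I.2 : ℚ) : ℝ)

/-- The cylinder `(σ(0) × ⋯ × σ(k-1) × ℝ × ℝ × ⋯) ∩ [0,1]^ω` given by a finite list `σ` of open
intervals with rational endpoints. These sets are the standard basis of `[0,1]^ω`. -/
def cylinderSet (σ : List IntervalIndex) : Set (ℕ → unitInterval) :=
  {x | ∀ (i : ℕ) (hi : i < σ.length), (x i : ℝ) ∈ IntervalIndex.toSet (σ[i])}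

/-- The finite union of cylinders given by a finite list of them. -/
def cylinderUnion (B : List (List IntervalIndex)) : Set (ℕ → unitInterval) :=
  {x | ∃ σ ∈ B, x ∈ cylinderSet σ}

/-! ### Representations of distributions and of moments -/

/-- The representation of a Borel probability measure `η` on `[0,1]^ω`: the set of all pairs
`(B, q)` of (the indices of) a finite union `B` of rational cylinders and a rational `q` such that
`η B > q`. -/
def distRep (η : Measure (ℕ → unitInterval)) : Set (List (List IntervalIndex) × RatIndex) :=
  {Bq | ((RatIndex.val Bq.2 : ℚ) : ℝ) < η.real (cylinderUnion Bq.1)}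

/-- `η` is a computable distribution: `η B` is a c.e. real, uniformly in `B`. -/
def ComputableDist (η : Measure (ℕ → unitInterval)) : Prop :=
  REPred fun Bq : List (List IntervalIndex) × RatIndex => Bq ∈ distRep η

/-- The mixed moment `E (x_{β(1)} ⋯ x_{β(k)})` of the coordinates of a random vector `x`, for a
finite sequence `β` of coordinates (with repetitions allowed). The empty sequence gives `1`. -/
noncomputable def mixedMoment {Ω : Type*} [MeasurableSpace Ω] (P : Measure Ω)
    (x : Ω → ℕ → unitInterval) (β : List ℕ) : ℝ :=
  ∫ ω, (β.map fun i => (x ω i : ℝ)).prod ∂P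

/-- The representation of the family of mixed moments: the set of all pairs `(β, I)` such that the
open interval `I` with rational endpoints contains the moment with index `β`. -/
def momentRep {Ω : Type*} [MeasurableSpace Ω] (P : Measure Ω) (x : Ω → ℕ → unitInterval) :
    Set (List ℕ × IntervalIndex) :=
  {βI | mixedMoment P x βI.1 ∈ IntervalIndex.toSet βI.2}

/-- The mixed moments are uniformly computable: they are computable reals, uniformly in `β`. -/
def ComputableMoments {Ω : Type*} [MeasurableSpace Ω] (P : Measure Ω)
    (x : Ω → ℕ → unitInterval) : Prop :=
  REPred fun βI : List ℕ × IntervalIndex => βI ∈ momentRep P x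

/-! ### Building oracle programs -/

namespace OracleCode

/-! Both directions reduce to one scheme. A set `A` is enumerable uniformly from listings of `B` as
soon as membership in `A` amounts to a finite witness that passes a primitive recursive check and
asks only for finitely many positive facts about `B` (`exists_computesFrom`). The program searches
through all witnesses and all initial segments of the listing. The strict inequalities in both
representations are what makes finite witnesses possible.

Distribution from moments (`mem_distRep_iff`): if `η U > q` for an open `U`, inner regularity,
Urysohn's lemma and Stone–Weierstrass give a rational polynomial strictly below the indicator of `U`
whose integral exceeds `q`. By compactness, evaluation at the corners of the cells of a sufficiently
fine grid verifies that the polynomial lies below the indicator. The integral of the polynomial is a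
combination of moments, so rational bounds on finitely many moments suffice.

Moments from distribution (`mem_momentRep_iff`): a monomial `f` has values in `[0,1]`, and its
integral is approximated by the average over `j < n` of the measures of the layers `{f > (j + 1) /
n}`. Each layer is exhausted in measure by finite unions of cylinders on which a rational lower
bound for `f` can be read off (`lt_integral_iff_exists_layersBelow`). Upper bounds come from the
same argument for `1 - f`.

Neither kind of witness mentions the random vector, so the programs are uniform. The statement on
computability follows because a c.e. set has a computable listing. -/

theorem eval_comp_of_eq_some {cf cg : OracleCode} {p : ℕ → ℕ} {n v : ℕ}
    (h : cg.eval p n = Part.some v) : (comp cf cg).eval p n = cf.eval p v := by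
  exact (congrArg (fun x : Part ℕ => x.bind (cf.eval p)) h).trans (Part.bind_some v _)

theorem eval_pair_of_eq_some {cf cg : OracleCode} {p : ℕ → ℕ} {n u v : ℕ}
    (hf : cf.eval p n = Part.some u) (hg : cg.eval p n = Part.some v) :
    (pair cf cg).eval p n = Part.some (Nat.pair u v) := by
  simp [eval, hf, hg, Seq.seq]

theorem exists_eval_eq_of_primrec {f : ℕ → ℕ} (hf : Nat.Primrec f) :
    ∃ c : OracleCode, ∀ p n, c.eval p n = Part.some (f n) := by
  induction hf with
  | zero => exact ⟨zero, fun _ _ => rfl⟩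
  | succ => exact ⟨succ, fun _ _ => rfl⟩
  | left => exact ⟨left, fun _ _ => rfl⟩
  | right => exact ⟨right, fun _ _ => rfl⟩
  | pair _ _ hf hg =>
    obtain ⟨cf, hf⟩ := hf
    obtain ⟨cg, hg⟩ := hg
    exact ⟨pair cf cg, fun p n => eval_pair_of_eq_some (hf p n) (hg p n)⟩
  | comp _ _ hf hg =>
    obtain ⟨cf, hf⟩ := hf
    obtain ⟨cg, hg⟩ := hg
    exact ⟨comp cf cg, fun p n => by rw [eval_comp_of_eq_some (hg p n), hf]⟩
  | @prec f g _ _ hf hg =>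
    obtain ⟨cf, hf⟩ := hf
    obtain ⟨cg, hg⟩ := hg
    refine ⟨prec cf cg, fun p n => ?_⟩
    simp only [eval, Nat.unpaired]
    induction n.unpair.2 with
    | zero => exact hf _ _
    | succ y ih =>
      refine (congrArg (fun x : Part ℕ => x.bind _) ih).trans ?_
      rw [Part.bind_some, hg]

/-- The list of the first `n` values of `p`, latest first. -/
def history (p : ℕ → ℕ) : ℕ → List ℕ
  | 0 => []
  | n + 1 => p n :: history p n

theorem mem_history {p : ℕ → ℕ} {n v : ℕ} : v ∈ history p n ↔ ∃ i < n, p i = v := by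
  induction n with
  | zero => simp [history]
  | succ n ih =>
    simp only [history, List.mem_cons, ih, Nat.lt_succ_iff_lt_or_eq]
    constructor
    · rintro (rfl | ⟨i, hi, rfl⟩)
      · exact ⟨n, .inr rfl, rfl⟩
      · exact ⟨i, .inl hi, rfl⟩
    · rintro ⟨i, hi | rfl, rfl⟩
      · exact .inr ⟨i, hi, rfl⟩
      · exact .inl rfl

theorem exists_eval_history :
    ∃ c : OracleCode, ∀ p n, c.eval p n = Part.some (Encodable.encode (history p n)) := by
  -- The code of `v :: l` is one more than the pair of `v` and the code of `l`. On `(0, (y, i))`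
  -- this queries the oracle at `y` and puts the answer in front of the list coded by `i`.
  let step : OracleCode :=
    comp succ (pair (comp oracle (comp left right)) (comp right right))
  -- `pair left right` is the identity, so the recursion runs on `n` with the dummy parameter `0`.
  refine ⟨comp (prec zero step) (pair zero (pair left right)), fun p n => ?_⟩
  have key : ∀ k : ℕ, (Nat.rec (eval p zero 0) (fun y IH => do
        let i ← IH
        eval p step (Nat.pair 0 (Nat.pair y i))) k : Part ℕ) =
      Part.some (Encodable.encode (history p k)) := by
    intro k
    induction k with
    | zero => rfl
    | succ k ih =>
      simp only [ih]
      simp [step, eval, Seq.seq, history]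
  simpa [eval, Seq.seq] using key n

theorem dom_rfind_iff {c : OracleCode} {p : ℕ → ℕ} {f : ℕ → ℕ}
    (hc : ∀ n, c.eval p n = Part.some (f n)) (m : ℕ) :
    ((rfind c).eval p m).Dom ↔ ∃ n, f (Nat.pair m n) = 0 := by
  refine Nat.rfind_dom.trans ?_
  simp [hc]

/-- A set `A` that is described from `B` by finitely many positive facts about `B`, as listed by a
primitive recursive witness, is computed from `B` by a program that does not depend on `B`. -/
theorem exists_computesFrom {α β W : Type*} [Primcodable α] [Primcodable β] [Primcodable W]
    {R : W → α → Prop} (hR : PrimrecRel R) {need : W → List β} (hneed : Primrec need) :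
    ∃ c : OracleCode, ∀ (A : Set α) (B : Set β),
      (∀ a, a ∈ A ↔ ∃ w, R w a ∧ ∀ b ∈ need w, b ∈ B) → c.ComputesFrom A B := by
  classical
  let T : ℕ → W → α → List ℕ → Prop := fun x w a s =>
    (Encodable.encode a = x ∧ R w a) ∧ ∀ b ∈ need w, ∃ v ∈ s, v = Encodable.encode b + 1
  -- The arguments are the input, the search number and the coded history. The search number carries
  -- the witness in its first component. The value `0` stops the search; a failed decoding or check
  -- gives `1`.
  let g : (ℕ × ℕ) × ℕ → ℕ := fun x =>
    ((Encodable.decode (α := W) x.1.2.unpair.1).bind fun w =>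
      (Encodable.decode (α := α) x.1.1).bind fun a =>
        (Encodable.decode (α := List ℕ) x.2).map fun s => if T x.1.1 w a s then 0 else 1).getD 1
  have hT : PrimrecPred fun y : ((((ℕ × ℕ) × ℕ) × W) × α) × List ℕ => T y.1.1.1.1.1 y.1.1.2 y.1.2 y.2 := by
    refine PrimrecPred.and (PrimrecPred.and ?_
      (hR.comp (Primrec.snd.comp (Primrec.fst.comp Primrec.fst))
      (Primrec.snd.comp Primrec.fst))) ?_
    · exact Primrec.eq.comp (Primrec.encode.comp (Primrec.snd.comp Primrec.fst))
        (Primrec.fst.comp (Primrec.fst.comp (Primrec.fst.comp (Primrec.fst.comp Primrec.fst))))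
    have h1 : PrimrecRel fun (v : ℕ) (b : β) => v = Encodable.encode b + 1 :=
      Primrec.eq.comp Primrec.fst (Primrec.succ.comp (Primrec.encode.comp Primrec.snd))
    have h2 : PrimrecRel fun (b : β) (s : List ℕ) => ∃ v ∈ s, v = Encodable.encode b + 1 :=
      h1.exists_mem_list.comp Primrec.snd Primrec.fst
    exact h2.forall_mem_list.comp
      (hneed.comp (Primrec.snd.comp (Primrec.fst.comp Primrec.fst))) Primrec.snd
  have hg : Primrec g := by
    refine Primrec.option_getD.comp (Primrec.option_bind (Primrec.decode.comp
      (Primrec.fst.comp (Primrec.unpair.comp (Primrec.snd.comp Primrec.fst))))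
      (Primrec.option_bind (Primrec.decode.comp
      (Primrec.fst.comp (Primrec.fst.comp Primrec.fst)))
      (Primrec.option_map (Primrec.decode.comp (Primrec.snd.comp (Primrec.fst.comp Primrec.fst)))
      (Primrec.ite hT (Primrec.const 0) (Primrec.const 1)).to₂).to₂).to₂) (Primrec.const 1)
  have hgn : Nat.Primrec fun n => g (n.unpair.1.unpair, n.unpair.2) :=
    Primrec.nat_iff.1 (hg.comp (Primrec.pair (Primrec.unpair.comp (Primrec.fst.comp Primrec.unpair))
      (Primrec.snd.comp Primrec.unpair)))
  obtain ⟨cg, hcg⟩ := exists_eval_eq_of_primrec hgn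
  obtain ⟨ch, hch⟩ := exists_eval_history
  refine ⟨rfind (comp cg (pair (pair left right) (comp ch right))), fun A B hAB p hp m => ?_⟩
  rw [dom_rfind_iff (f := fun n => g (n.unpair, Encodable.encode (history p n.unpair.2)))
    (fun n => by
      rw [eval_comp_of_eq_some (eval_pair_of_eq_some (eval_pair_of_eq_some rfl rfl)
        ((eval_comp_of_eq_some rfl).trans (hch p _))), hcg]
      simp)]
  simp only [Nat.unpair_pair]
  have hg0 : ∀ x n s, g ((x, n), Encodable.encode s) = 0 ↔
      ∃ w a, Encodable.decode (α := W) n.unpair.1 = some w ∧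
        Encodable.decode (α := α) x = some a ∧ T x w a s := by
    intro x n s
    simp only [g, Encodable.encodek]
    rcases Encodable.decode (α := W) n.unpair.1 with _ | w
    · simp
    rcases Encodable.decode (α := α) x with _ | a
    · simp
    by_cases h : T x w a s <;> simp [h]
  simp only [hg0]
  constructor
  · rintro ⟨n, w, a, -, -, ⟨rfl, hR⟩, hmem⟩
    refine ⟨a, (hAB a).2 ⟨w, hR, fun b hb => ?_⟩, rfl⟩
    obtain ⟨v, hv, rfl⟩ := hmem b hb
    obtain ⟨i, -, hi⟩ := mem_history.1 hv
    obtain ⟨b', hb', he⟩ := (hp _).1 ⟨i, hi⟩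
    rwa [← Encodable.encode_injective he]
  · rintro ⟨a, ha, rfl⟩
    obtain ⟨w, hw, hB⟩ := (hAB a).1 ha
    -- Finitely many facts are all listed before a common stage.
    have : ∀ l : List β, (∀ b ∈ l, b ∈ B) →
        ∃ N, ∀ b ∈ l, ∃ i < N, p i = Encodable.encode b + 1 := by
      intro l hl
      induction l with
      | nil => exact ⟨0, by simp⟩
      | cons b l ih =>
        obtain ⟨N, hN⟩ := ih fun b hb => hl b (List.mem_cons_of_mem _ hb)
        obtain ⟨i, hi⟩ := (hp _).2 ⟨b, hl b List.mem_cons_self, rfl⟩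
        refine ⟨max N (i + 1), fun b' hb' => ?_⟩
        rcases List.mem_cons.1 hb' with rfl | hb'
        · exact ⟨i, by omega, hi⟩
        · obtain ⟨j, hj, h⟩ := hN b' hb'
          exact ⟨j, by omega, h⟩
    obtain ⟨N, hN⟩ := this _ hB
    -- The history read has the search number itself as its length, and this is at least `N`.
    refine ⟨Nat.pair (Encodable.encode w) N, w, a, by simp, by simp, ⟨rfl, hw⟩, fun b hb => ?_⟩
    obtain ⟨i, hi, h⟩ := hN b hb
    exact ⟨_, mem_history.2 ⟨i, hi.trans_le (Nat.right_le_pair _ _), rfl⟩, h⟩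

/-! ### Computable oracles and c.e. sets -/

theorem partrec_eval {p : ℕ → ℕ} (hp : Computable p) (c : OracleCode) :
    Nat.Partrec (c.eval p) := by
  induction c with
  | zero => exact .zero
  | succ => exact .succ
  | left => exact .left
  | right => exact .right
  | oracle => exact Partrec.nat_iff.1 hp
  | pair _ _ hf hg => exact .pair hf hg
  | comp _ _ hf hg => exact .comp hf hg
  | prec _ _ hf hg => exact .prec hf hg
  | rfind _ hf => exact .rfind hf

/-- A set that is computed from a c.e. set is c.e. -/
theorem ComputesFrom.rePred {α β : Type*} [Primcodable α] [Primcodable β]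
    {c : OracleCode} {A : Set α} {B : Set β} (h : c.ComputesFrom A B)
    {p : ℕ → ℕ} (hp : Computable p) (hB : IsListing p B) : REPred fun a => a ∈ A := by
  have h1 : Partrec fun a : α => c.eval p (Encodable.encode a) :=
    (Partrec.nat_iff.2 (partrec_eval hp c)).comp Computable.encode
  refine h1.dom_re.of_eq fun a => (h p hB _).trans ⟨?_, fun ha => ⟨a, ha, rfl⟩⟩
  rintro ⟨b, hb, he⟩
  rwa [← Encodable.encode_injective he]

end OracleCode

/-- Dovetailing: a number codes a step bound and a candidate, and the candidate is listed if the
semi-decision procedure halts on it within the bound. -/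
theorem exists_computable_isListing {α : Type*} [Primcodable α] {A : Set α}
    (hA : REPred fun a => a ∈ A) : ∃ p : ℕ → ℕ, Computable p ∧ IsListing p A := by
  obtain ⟨c, hc⟩ := Nat.Partrec.Code.exists_code.1 hA
  -- The code of `some a` is the code of `a` plus one, and that of `none` is `0`, as a listing
  -- requires.
  refine ⟨fun n => bif (Nat.Partrec.Code.evaln n.unpair.1 c n.unpair.2).isSome
    then Encodable.encode (Encodable.decode (α := α) n.unpair.2) else 0, ?_, fun m => ?_⟩
  · have h1 : Primrec fun n : ℕ => Nat.Partrec.Code.evaln n.unpair.1 c n.unpair.2 :=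
      Nat.Partrec.Code.primrec_evaln.comp (Primrec.pair (Primrec.pair
        (Primrec.fst.comp Primrec.unpair) (Primrec.const c)) (Primrec.snd.comp Primrec.unpair))
    exact (Primrec.cond (Primrec.option_isSome.comp h1)
      (Primrec.encdec.comp (Primrec.snd.comp Primrec.unpair)) (Primrec.const 0)).to_comp
  · have h2 : ∀ x, (∃ k, (Nat.Partrec.Code.evaln k c x).isSome) ↔ (c.eval x).Dom := by
      intro x
      simp only [Part.dom_iff_mem, Nat.Partrec.Code.evaln_complete, Option.isSome_iff_exists,
        Option.mem_def]
      exact exists_comm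
    constructor
    · rintro ⟨n, hn⟩
      by_cases h : (Nat.Partrec.Code.evaln n.unpair.1 c n.unpair.2).isSome
      · have h3 := (h2 _).1 ⟨_, h⟩
        rw [hc] at h3
        rcases ha : Encodable.decode (α := α) n.unpair.2 with _ | a
        · simp [ha] at hn
        · simp only [ha, h, cond_true, Encodable.encode_some, Nat.succ_eq_add_one,
            Nat.add_right_cancel_iff] at hn
          simp only [ha, Part.coe_some, Part.bind_some] at h3
          exact ⟨a, h3.fst, hn⟩
      · simp [h] at hn
    · rintro ⟨a, ha, rfl⟩
      obtain ⟨k, hk⟩ := (h2 (Encodable.encode a)).2 (by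
        rw [hc]; simpa using ⟨ha, trivial⟩)
      exact ⟨Nat.pair k (Encodable.encode a), by simp [hk]⟩

/-! ### Primitive recursive functions with rational values -/

/-- The map `f` into the rationals is primitive recursive, in the sense that an index of `f a` can
be found primitive recursively. -/
def PrimrecRat {α : Type*} [Primcodable α] (f : α → ℚ) : Prop :=
  ∃ g : α → RatIndex, Primrec g ∧ ∀ a, (g a).val = f a

/-- Cross-multiplication, with negative parts moved to the other side so that no subtraction in `ℕ`
occurs. -/
theorem RatIndex.val_lt_val_iff (r s : RatIndex) : r.val < s.val ↔
    r.1.1 * (s.2 + 1) + s.1.2 * (r.2 + 1) < s.1.1 * (r.2 + 1) + r.1.2 * (s.2 + 1) := by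
  rw [RatIndex.val, RatIndex.val, div_lt_div_iff₀ (by positivity) (by positivity),
    ← Nat.cast_lt (α := ℚ)]
  push_cast
  constructor <;> intro h <;> linarith

namespace PrimrecRat

variable {α β γ : Type*} [Primcodable α] [Primcodable β] [Primcodable γ]

theorem of_eq {f g : α → ℚ} (hf : PrimrecRat f) (h : ∀ a, f a = g a) : PrimrecRat g :=
  (funext h : f = g) ▸ hf

theorem comp {f : β → ℚ} {g : α → β} (hf : PrimrecRat f) (hg : Primrec g) :
    PrimrecRat fun a => f (g a) := by
  obtain ⟨F, hF, h⟩ := hf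
  exact ⟨fun a => F (g a), hF.comp hg, fun a => h _⟩

theorem val {f : α → RatIndex} (hf : Primrec f) : PrimrecRat fun a => (f a).val :=
  ⟨f, hf, fun _ => rfl⟩

theorem div_succ {f g : α → ℕ} (hf : Primrec f) (hg : Primrec g) :
    PrimrecRat fun a => (f a : ℚ) / ((g a : ℚ) + 1) :=
  ⟨fun a => ((f a, 0), g a), (hf.pair (Primrec.const 0)).pair hg, fun a => by simp [RatIndex.val]⟩

theorem natCast {f : α → ℕ} (hf : Primrec f) : PrimrecRat fun a => (f a : ℚ) :=
  (div_succ hf (Primrec.const 0)).of_eq fun a => by simp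

theorem add {f g : α → ℚ} (hf : PrimrecRat f) (hg : PrimrecRat g) :
    PrimrecRat fun a => f a + g a := by
  obtain ⟨F, hF, hf⟩ := hf
  obtain ⟨G, hG, hg⟩ := hg
  have pF := Primrec.fst.comp (Primrec.fst.comp hF)
  have nF := Primrec.snd.comp (Primrec.fst.comp hF)
  have dF := Primrec.snd.comp hF
  have pG := Primrec.fst.comp (Primrec.fst.comp hG)
  have nG := Primrec.snd.comp (Primrec.fst.comp hG)
  have dG := Primrec.snd.comp hG
  -- Denominators are stored minus one: `(d + 1) * (e + 1) - 1 = d * e + d + e`.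
  refine ⟨fun a => (((F a).1.1 * ((G a).2 + 1) + (G a).1.1 * ((F a).2 + 1),
    (F a).1.2 * ((G a).2 + 1) + (G a).1.2 * ((F a).2 + 1)), (F a).2 * (G a).2 + (F a).2 + (G a).2),
    ((Primrec.nat_add.comp (Primrec.nat_mul.comp pF (Primrec.succ.comp dG))
      (Primrec.nat_mul.comp pG (Primrec.succ.comp dF))).pair
    (Primrec.nat_add.comp (Primrec.nat_mul.comp nF (Primrec.succ.comp dG))
      (Primrec.nat_mul.comp nG (Primrec.succ.comp dF)))).pair
    (Primrec.nat_add.comp (Primrec.nat_add.comp (Primrec.nat_mul.comp dF dG) dF) dG), fun a => ?_⟩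
  beta_reduce
  rw [← hf, ← hg, RatIndex.val, RatIndex.val, RatIndex.val, div_add_div _ _ (by positivity)
    (by positivity)]
  push_cast
  congr 1 <;> ring

theorem mul {f g : α → ℚ} (hf : PrimrecRat f) (hg : PrimrecRat g) :
    PrimrecRat fun a => f a * g a := by
  obtain ⟨F, hF, hf⟩ := hf
  obtain ⟨G, hG, hg⟩ := hg
  have pF := Primrec.fst.comp (Primrec.fst.comp hF)
  have nF := Primrec.snd.comp (Primrec.fst.comp hF)
  have dF := Primrec.snd.comp hF
  have pG := Primrec.fst.comp (Primrec.fst.comp hG)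
  have nG := Primrec.snd.comp (Primrec.fst.comp hG)
  have dG := Primrec.snd.comp hG
  refine ⟨fun a => (((F a).1.1 * (G a).1.1 + (F a).1.2 * (G a).1.2,
    (F a).1.1 * (G a).1.2 + (F a).1.2 * (G a).1.1), (F a).2 * (G a).2 + (F a).2 + (G a).2),
    ((Primrec.nat_add.comp (Primrec.nat_mul.comp pF pG) (Primrec.nat_mul.comp nF nG)).pair
    (Primrec.nat_add.comp (Primrec.nat_mul.comp pF nG) (Primrec.nat_mul.comp nF pG))).pair
    (Primrec.nat_add.comp (Primrec.nat_add.comp (Primrec.nat_mul.comp dF dG) dF) dG), fun a => ?_⟩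
  beta_reduce
  rw [← hf, ← hg, RatIndex.val, RatIndex.val, RatIndex.val, div_mul_div_comm]
  push_cast
  congr 1 <;> ring

theorem neg {f : α → ℚ} (hf : PrimrecRat f) : PrimrecRat fun a => -f a := by
  obtain ⟨F, hF, hf⟩ := hf
  refine ⟨fun a => (((F a).1.2, (F a).1.1), (F a).2), ((Primrec.snd.comp (Primrec.fst.comp hF)).pair
    (Primrec.fst.comp (Primrec.fst.comp hF))).pair (Primrec.snd.comp hF), fun a => ?_⟩
  beta_reduce
  rw [← hf, RatIndex.val, RatIndex.val, ← neg_div, neg_sub]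

theorem sub {f g : α → ℚ} (hf : PrimrecRat f) (hg : PrimrecRat g) :
    PrimrecRat fun a => f a - g a :=
  (hf.add hg.neg).of_eq fun _ => (sub_eq_add_neg _ _).symm

theorem lt {f g : α → ℚ} (hf : PrimrecRat f) (hg : PrimrecRat g) :
    PrimrecPred fun a => f a < g a := by
  obtain ⟨F, hF, hf⟩ := hf
  obtain ⟨G, hG, hg⟩ := hg
  have pF := Primrec.fst.comp (Primrec.fst.comp hF)
  have nF := Primrec.snd.comp (Primrec.fst.comp hF)
  have dF := Primrec.succ.comp (Primrec.snd.comp hF)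
  have pG := Primrec.fst.comp (Primrec.fst.comp hG)
  have nG := Primrec.snd.comp (Primrec.fst.comp hG)
  have dG := Primrec.succ.comp (Primrec.snd.comp hG)
  refine PrimrecPred.of_eq (Primrec.nat_lt.comp
    (Primrec.nat_add.comp (Primrec.nat_mul.comp pF dG) (Primrec.nat_mul.comp nG dF))
    (Primrec.nat_add.comp (Primrec.nat_mul.comp pG dF) (Primrec.nat_mul.comp nF dG))) fun a => ?_
  rw [← hf, ← hg, RatIndex.val_lt_val_iff]

theorem le {f g : α → ℚ} (hf : PrimrecRat f) (hg : PrimrecRat g) :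
    PrimrecPred fun a => f a ≤ g a :=
  (hg.lt hf).not.of_eq fun _ => not_lt

theorem ite {c : α → Prop} [DecidablePred c] {f g : α → ℚ} (hc : PrimrecPred c)
    (hf : PrimrecRat f) (hg : PrimrecRat g) : PrimrecRat fun a => if c a then f a else g a := by
  obtain ⟨F, hF, hf⟩ := hf
  obtain ⟨G, hG, hg⟩ := hg
  refine ⟨fun a => if c a then F a else G a, Primrec.ite hc hF hG, fun a => ?_⟩
  beta_reduce
  split_ifs
  · exact hf a
  · exact hg a

theorem max {f g : α → ℚ} (hf : PrimrecRat f) (hg : PrimrecRat g) :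
    PrimrecRat fun a => max (f a) (g a) :=
  (ite (hf.le hg) hg hf).of_eq fun _ => (max_def _ _).symm

theorem min {f g : α → ℚ} (hf : PrimrecRat f) (hg : PrimrecRat g) :
    PrimrecRat fun a => min (f a) (g a) :=
  (ite (hf.le hg) hf hg).of_eq fun _ => (min_def _ _).symm

/-- Folding a primitive recursive operation on rationals over a list. -/
theorem list_foldr {l : α → List β} {f : α → β → ℚ} {op : ℚ → ℚ → ℚ} {e : ℚ}
    (hop : ∀ f g : α × β × RatIndex → ℚ, PrimrecRat f → PrimrecRat g →
      PrimrecRat fun x => op (f x) (g x))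
    (hl : Primrec l) (hf : PrimrecRat fun x : α × β => f x.1 x.2) :
    PrimrecRat fun a => ((l a).map (f a)).foldr op e := by
  -- With the index of the accumulator as a further variable, `hop` yields an operation `G` on
  -- indices, and `G` can be folded.
  obtain ⟨G, hG, hg⟩ := hop (fun x => f x.1 x.2.1) (fun x => x.2.2.val)
    (hf.comp (Primrec.fst.pair (Primrec.fst.comp Primrec.snd)))
    (val (Primrec.snd.comp Primrec.snd))
  obtain ⟨z, hz⟩ := RatIndex.val_surjective e
  refine ⟨fun a => (l a).foldr (fun b s => G (a, b, s)) z, Primrec.list_foldr hl (Primrec.const z)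
    hG.to₂, fun a => ?_⟩
  beta_reduce
  induction l a with
  | nil => exact hz
  | cons b l ih => simp only [List.foldr_cons, List.map_cons, hg, ih]

theorem list_sum {l : α → List β} {f : α → β → ℚ} (hl : Primrec l)
    (hf : PrimrecRat fun x : α × β => f x.1 x.2) : PrimrecRat fun a => ((l a).map (f a)).sum :=
  (list_foldr (op := (· + ·)) (e := 0) (fun _ _ => add) hl hf).of_eq fun _ =>
    List.sum_eq_foldr.symm

theorem list_prod {l : α → List β} {f : α → β → ℚ} (hl : Primrec l)
    (hf : PrimrecRat fun x : α × β => f x.1 x.2) : PrimrecRat fun a => ((l a).map (f a)).prod :=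
  (list_foldr (op := (· * ·)) (e := 1) (fun _ _ => mul) hl hf).of_eq fun _ =>
    List.prod_eq_foldr.symm

end PrimrecRat

/-! ### Bounded quantifiers -/

namespace PrimrecPred

variable {α β : Type*} [Primcodable α] [Primcodable β]

theorem forall_mem_of_primrec {l : α → List β} {p : α → β → Prop} (hl : Primrec l)
    (hp : PrimrecPred fun x : α × β => p x.1 x.2) : PrimrecPred fun a => ∀ b ∈ l a, p a b := by
  have h : PrimrecRel fun (b : β) (a : α) => p a b := hp.comp (Primrec.snd.pair Primrec.fst)
  exact h.forall_mem_list.comp hl Primrec.id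

theorem forall_lt_of_primrec {n : α → ℕ} {p : α → ℕ → Prop} (hn : Primrec n)
    (hp : PrimrecPred fun x : α × ℕ => p x.1 x.2) : PrimrecPred fun a => ∀ i < n a, p a i :=
  (forall_mem_of_primrec (Primrec.list_range.comp hn) hp).of_eq fun a => by simp

theorem exists_mem_of_primrec {l : α → List β} {p : α → β → Prop} (hl : Primrec l)
    (hp : PrimrecPred fun x : α × β => p x.1 x.2) : PrimrecPred fun a => ∃ b ∈ l a, p a b := by
  have h : PrimrecRel fun (b : β) (a : α) => p a b := hp.comp (Primrec.snd.pair Primrec.fst)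
  exact h.exists_mem_list.comp hl Primrec.id

end PrimrecPred

theorem Primrec.nat_pow : Primrec₂ ((· ^ ·) : ℕ → ℕ → ℕ) :=
  Primrec₂.unpaired'.1 Nat.Primrec.pow

/-! ### Monomials, polynomials and cylinders on the Hilbert cube -/

/-- The monomial `x ↦ x_{β(1)} ⋯ x_{β(k)}` on `[0,1]^ω`. -/
def cubeMonomial (β : List ℕ) (x : ℕ → unitInterval) : ℝ :=
  (β.map fun i => (x i : ℝ)).prod

/-- The polynomial on `[0,1]^ω` with natural coefficients that is given by the list of its
monomials. -/
def cubePoly (P : List (List ℕ)) (x : ℕ → unitInterval) : ℝ :=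
  (P.map fun β => cubeMonomial β x).sum

theorem continuous_cubeMonomial (β : List ℕ) : Continuous (cubeMonomial β) := by
  refine continuous_list_prod _ fun i _ => ?_
  fun_prop

theorem continuous_cubePoly (P : List (List ℕ)) : Continuous (cubePoly P) :=
  continuous_list_sum _ fun β _ => continuous_cubeMonomial β

theorem cubeMonomial_nonneg (β : List ℕ) (x : ℕ → unitInterval) : 0 ≤ cubeMonomial β x := by
  refine List.prod_nonneg fun a ha => ?_
  obtain ⟨i, -, rfl⟩ := List.mem_map.1 ha
  exact (x i).2.1

theorem cubeMonomial_le_one (β : List ℕ) (x : ℕ → unitInterval) : cubeMonomial β x ≤ 1 := by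
  induction β with
  | nil => simp [cubeMonomial]
  | cons i β ih =>
    have h : cubeMonomial (i :: β) x = x i * cubeMonomial β x := by simp [cubeMonomial]
    rw [h]
    exact mul_le_one₀ (x i).2.2 (cubeMonomial_nonneg β x) ih

theorem cubePoly_nonneg (P : List (List ℕ)) (x : ℕ → unitInterval) : 0 ≤ cubePoly P x := by
  refine List.sum_nonneg fun a ha => ?_
  obtain ⟨β, -, rfl⟩ := List.mem_map.1 ha
  exact cubeMonomial_nonneg β x

theorem cubePoly_cons (β : List ℕ) (P : List (List ℕ)) (x : ℕ → unitInterval) :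
    cubePoly (β :: P) x = cubeMonomial β x + cubePoly P x := by
  simp [cubePoly]

theorem cubePoly_append (P Q : List (List ℕ)) (x : ℕ → unitInterval) :
    cubePoly (P ++ Q) x = cubePoly P x + cubePoly Q x := by
  simp [cubePoly]

theorem cubePoly_le_length (P : List (List ℕ)) (x : ℕ → unitInterval) :
    cubePoly P x ≤ P.length := by
  induction P with
  | nil => simp [cubePoly]
  | cons β P ih =>
    rw [cubePoly_cons, List.length_cons]
    push_cast
    linarith [cubeMonomial_le_one β x]

/-- Coefficients are encoded by repetition, so this is how a polynomial is scaled. -/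
theorem cubePoly_replicate (n : ℕ) (P : List (List ℕ)) (x : ℕ → unitInterval) :
    cubePoly (List.replicate n P).flatten x = n * cubePoly P x := by
  induction n with
  | zero => simp [cubePoly]
  | succ n ih =>
    rw [List.replicate_succ, List.flatten_cons, cubePoly_append, ih]
    push_cast
    ring

theorem mem_cylinderSet_iff {σ : List IntervalIndex} {x : ℕ → unitInterval} :
    x ∈ cylinderSet σ ↔ ∀ i < σ.length, (((σ.getD i default).1.val : ℚ) : ℝ) < x i ∧
      (x i : ℝ) < ((σ.getD i default).2.val : ℚ) := by
  simp only [cylinderSet, IntervalIndex.toSet, Set.mem_ofPred_eq, Set.mem_Ioo]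
  refine forall₂_congr fun i hi => ?_
  rw [List.getD_eq_getElem _ _ hi]

theorem isOpen_cylinderSet (σ : List IntervalIndex) : IsOpen (cylinderSet σ) := by
  have : cylinderSet σ = ⋂ i ∈ Finset.range σ.length,
      (fun x : ℕ → unitInterval => (x i : ℝ)) ⁻¹'
        Set.Ioo (((σ.getD i default).1.val : ℚ) : ℝ) ((σ.getD i default).2.val : ℚ) := by
    ext x
    simp [mem_cylinderSet_iff]
  rw [this]
  exact isOpen_biInter_finset fun i _ => isOpen_Ioo.preimage (by fun_prop)

theorem isOpen_cylinderUnion (B : List (List IntervalIndex)) : IsOpen (cylinderUnion B) := by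
  have : cylinderUnion B = ⋃ σ ∈ B, cylinderSet σ := by
    ext x
    simp [cylinderUnion]
  rw [this]
  exact isOpen_biUnion fun σ _ => isOpen_cylinderSet σ

/-! ### Polynomial approximation -/

/-- Stone–Weierstrass on the Hilbert cube, with rational coefficients. -/
theorem exists_cubePoly_approx (f : C(ℕ → unitInterval, ℝ)) {ε : ℝ} (hε : 0 < ε) :
    ∃ (P Q : List (List ℕ)) (D : ℕ), 0 < D ∧
      ∀ x, |f x - (cubePoly P x - cubePoly Q x) / D| < ε := by
  let coord : ℕ → C(ℕ → unitInterval, ℝ) := fun i => ⟨fun x => (x i : ℝ), by fun_prop⟩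
  let A : Subalgebra ℝ C(ℕ → unitInterval, ℝ) := Algebra.adjoin ℝ (Set.range coord)
  have hA : A.topologicalClosure = ⊤ := by
    refine ContinuousMap.subalgebra_topologicalClosure_eq_top_of_separatesPoints A ?_
    intro x y hxy
    obtain ⟨i, hi⟩ := Function.ne_iff.1 hxy
    exact ⟨coord i, ⟨coord i, Algebra.subset_adjoin ⟨i, rfl⟩, rfl⟩,
      fun h => hi (Subtype.ext h)⟩
  -- The algebra generated by the coordinates is the linear span of the monomials. The error stays
  -- quantified because the sum and scalar cases call for smaller errors.
  have key : ∀ g ∈ Submodule.span ℝ (Submonoid.closure (Set.range coord) :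
      Set C(ℕ → unitInterval, ℝ)), ∀ ε : ℝ, 0 < ε → ∃ (P Q : List (List ℕ)) (D : ℕ), 0 < D ∧
      ∀ x, |g x - (cubePoly P x - cubePoly Q x) / D| < ε := by
    intro g hg
    induction hg using Submodule.span_induction with
    | mem g hg =>
      intro ε hε
      obtain ⟨l, hl, rfl⟩ := Submonoid.exists_list_of_mem_closure hg
      have : ∃ β : List ℕ, ∀ x, l.prod x = cubeMonomial β x := by
        clear hg
        induction l with
        | nil => exact ⟨[], fun x => by simp [cubeMonomial]⟩
        | cons a l ih =>
          obtain ⟨β, hβ⟩ := ih fun y hy => hl y (List.mem_cons_of_mem _ hy)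
          obtain ⟨i, rfl⟩ := hl a List.mem_cons_self
          exact ⟨i :: β, fun x => by simp [cubeMonomial, hβ, coord]⟩
      obtain ⟨β, hβ⟩ := this
      exact ⟨[β], [], 1, one_pos, fun x => by simpa [cubePoly, hβ] using hε⟩
    | zero =>
      intro ε hε
      exact ⟨[], [], 1, one_pos, fun x => by simpa using hε⟩
    | add g h _ _ ihg ihh =>
      intro ε hε
      obtain ⟨P, Q, D, hD, hg⟩ := ihg (ε / 2) (half_pos hε)
      obtain ⟨P', Q', D', hD', hh⟩ := ihh (ε / 2) (half_pos hε)
      refine ⟨(List.replicate D' P).flatten ++ (List.replicate D P').flatten,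
        (List.replicate D' Q).flatten ++ (List.replicate D Q').flatten, D * D',
        Nat.mul_pos hD hD', fun x => ?_⟩
      have h1 : (D : ℝ) ≠ 0 := by positivity
      have h2 : (D' : ℝ) ≠ 0 := by positivity
      have e : (g + h) x - (cubePoly ((List.replicate D' P).flatten ++
          (List.replicate D P').flatten) x - cubePoly ((List.replicate D' Q).flatten ++
          (List.replicate D Q').flatten) x) / ((D * D' : ℕ) : ℝ) =
          (g x - (cubePoly P x - cubePoly Q x) / D) +
          (h x - (cubePoly P' x - cubePoly Q' x) / D') := by
        simp only [cubePoly_append, cubePoly_replicate, ContinuousMap.add_apply]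
        push_cast
        field_simp
        ring
      rw [e]
      exact (abs_add_le _ _).trans_lt (by linarith [hg x, hh x])
    | smul c g _ ih =>
      intro ε hε
      -- Half of `ε` is spent on `g`, with `+ 1` covering `c = 0`. The other half pays for replacing
      -- `c` by a rational `r`; there `M` bounds the polynomial, as monomials take values in
      -- `[0,1]`.
      obtain ⟨P, Q, D, hD, hg⟩ := ih (ε / (2 * (|c| + 1))) (by positivity)
      set M : ℝ := P.length + Q.length + 1
      have hM : 0 < M := by positivity
      obtain ⟨r, hr1, hr2⟩ := exists_rat_btwn (show c < c + ε / (2 * M) by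
        linarith [show 0 < ε / (2 * M) by positivity])
      -- Multiplication by the negative part of `r` exchanges the roles of `P` and `Q`.
      refine ⟨(List.replicate r.num.toNat P).flatten ++ (List.replicate (-r.num).toNat Q).flatten,
        (List.replicate r.num.toNat Q).flatten ++ (List.replicate (-r.num).toNat P).flatten,
        r.den * D, Nat.mul_pos r.pos hD, fun x => ?_⟩
      have h1 : (D : ℝ) ≠ 0 := by positivity
      have h2 : (r.den : ℝ) ≠ 0 := by exact_mod_cast r.den_nz
      have h3 : (r.num.toNat : ℝ) - ((-r.num).toNat : ℝ) = r * r.den := by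
        have h4 : ((r.num.toNat : ℤ) : ℝ) - (((-r.num).toNat : ℤ) : ℝ) = (r.num : ℝ) := by
          rw [← Int.cast_sub]; congr 1; omega
        have h5 : (r.num : ℝ) = r * r.den := by
          exact_mod_cast (Rat.mul_den_eq_num r).symm
        rw [← h5, ← h4, Int.cast_natCast, Int.cast_natCast]
      have e : (c • g) x - (cubePoly ((List.replicate r.num.toNat P).flatten ++
          (List.replicate (-r.num).toNat Q).flatten) x - cubePoly ((List.replicate r.num.toNat
          Q).flatten ++ (List.replicate (-r.num).toNat P).flatten) x) / ((r.den * D : ℕ) : ℝ) =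
          c * (g x - (cubePoly P x - cubePoly Q x) / D) +
          (c - r) * ((cubePoly P x - cubePoly Q x) / D) := by
        have e1 : cubePoly ((List.replicate r.num.toNat P).flatten ++
          (List.replicate (-r.num).toNat Q).flatten) x - cubePoly ((List.replicate r.num.toNat
          Q).flatten ++ (List.replicate (-r.num).toNat P).flatten) x =
          (r * r.den) * (cubePoly P x - cubePoly Q x) := by
          simp only [cubePoly_append, cubePoly_replicate]
          rw [← h3]
          ring
        rw [e1]
        simp only [ContinuousMap.smul_apply, smul_eq_mul]
        push_cast
        field_simp
        ring
      rw [e]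
      have b1 : |c * (g x - (cubePoly P x - cubePoly Q x) / D)| ≤ ε / 2 := by
        rw [abs_mul]
        calc |c| * |g x - (cubePoly P x - cubePoly Q x) / D|
            ≤ (|c| + 1) * (ε / (2 * (|c| + 1))) :=
              mul_le_mul (by linarith) (hg x).le (abs_nonneg _) (by positivity)
          _ = ε / 2 := by field_simp
      have b2 : |(c - r) * ((cubePoly P x - cubePoly Q x) / D)| < ε / 2 := by
        have hD1 : (1 : ℝ) ≤ D := by exact_mod_cast hD
        have b3 : |(cubePoly P x - cubePoly Q x) / D| < M := by
          rw [abs_div, Nat.abs_cast]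
          refine (div_le_self (abs_nonneg _) hD1).trans_lt (abs_lt.2 ⟨?_, ?_⟩) <;>
          linarith [cubePoly_nonneg P x, cubePoly_nonneg Q x, cubePoly_le_length P x,
            cubePoly_le_length Q x, (Nat.cast_nonneg P.length : (0 : ℝ) ≤ _),
            (Nat.cast_nonneg Q.length : (0 : ℝ) ≤ _),
            show M = P.length + Q.length + 1 from rfl]
        rw [abs_mul]
        calc |c - r| * |(cubePoly P x - cubePoly Q x) / D|
            < ε / (2 * M) * M := by
              refine mul_lt_mul'' ?_ b3 (abs_nonneg _) (abs_nonneg _)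
              rw [abs_sub_comm, abs_of_pos (by linarith)]
              linarith
          _ = ε / 2 := by field_simp
      exact (abs_add_le _ _).trans_lt (by linarith)
  have hf : f ∈ closure (A : Set C(ℕ → unitInterval, ℝ)) := by
    rw [← Subalgebra.topologicalClosure_coe, hA]
    trivial
  obtain ⟨g, hg, hfg⟩ := Metric.mem_closure_iff.1 hf (ε / 2) (half_pos hε)
  rw [ContinuousMap.dist_lt_iff (half_pos hε)] at hfg
  have hg' : g ∈ Subalgebra.toSubmodule A := hg
  rw [Algebra.adjoin_eq_span] at hg'
  obtain ⟨P, Q, D, hD, h⟩ := key g hg' (ε / 2) (half_pos hε)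
  refine ⟨P, Q, D, hD, fun x => ?_⟩
  have h1 := hfg x
  rw [Real.dist_eq] at h1
  calc |f x - (cubePoly P x - cubePoly Q x) / D|
      = |(f x - g x) + (g x - (cubePoly P x - cubePoly Q x) / D)| := by ring_nf
    _ < ε := (abs_add_le _ _).trans_lt (by linarith [h x])

/-! ### Lower bounds for the measure of an open set by moments -/

theorem integrable_cubePoly (η : Measure (ℕ → unitInterval)) [IsFiniteMeasure η]
    (P : List (List ℕ)) : Integrable (cubePoly P) η :=
  (continuous_cubePoly P).integrable_of_hasCompactSupport (HasCompactSupport.of_compactSpace _)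

theorem integrable_cubeMonomial (η : Measure (ℕ → unitInterval)) [IsFiniteMeasure η]
    (β : List ℕ) : Integrable (cubeMonomial β) η :=
  (continuous_cubeMonomial β).integrable_of_hasCompactSupport (HasCompactSupport.of_compactSpace _)

theorem integral_cubePoly (η : Measure (ℕ → unitInterval)) [IsFiniteMeasure η]
    (P : List (List ℕ)) :
    ∫ x, cubePoly P x ∂η = (P.map fun β => ∫ x, cubeMonomial β x ∂η).sum := by
  induction P with
  | nil => simp [cubePoly]
  | cons β P ih =>
    simp only [cubePoly_cons, List.map_cons, List.sum_cons]
    rw [integral_add (integrable_cubeMonomial η β) (integrable_cubePoly η P), ih]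

/-- A rational lower bound for the measure of an open set is witnessed by a polynomial that is
strictly below the indicator function. -/
theorem exists_cubePoly_lt_indicator (η : Measure (ℕ → unitInterval)) [IsProbabilityMeasure η]
    {U : Set (ℕ → unitInterval)} (hU : IsOpen U) {q : ℝ} (hq : q < η.real U) :
    ∃ (P Q : List (List ℕ)) (D : ℕ),
      (∀ x, cubePoly P x - cubePoly Q x < D) ∧
      (∀ x ∉ U, cubePoly P x - cubePoly Q x < 0) ∧
      q * D < ∫ x, (cubePoly P x - cubePoly Q x) ∂η := by
  -- For `q ≥ 0`, `f` is a Urysohn function that is `1` on a closed subset of `U` of measure above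
  -- `q` and `0` off `U`.
  obtain ⟨f, hf0, hf1, hfU, hfq⟩ : ∃ f : C(ℕ → unitInterval, ℝ), (∀ x, 0 ≤ f x) ∧
      (∀ x, f x ≤ 1) ∧ (∀ x ∉ U, f x = 0) ∧ q < ∫ x, f x ∂η := by
    rcases lt_or_ge q 0 with h | h
    · exact ⟨0, by simp, by simp, by simp, by simpa using h⟩
    have h1 : ENNReal.ofReal q < η U := by
      rwa [ENNReal.ofReal_lt_iff_lt_toReal h (measure_ne_top _ _)]
    obtain ⟨F, hFU, hF, hqF⟩ := hU.exists_lt_isClosed h1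
    obtain ⟨f, hf0, hf1, hf⟩ := exists_continuous_zero_one_of_isClosed hU.isClosed_compl hF
      (Set.disjoint_left.2 fun x hx hx' => hx (hFU hx'))
    refine ⟨f, fun x => (hf x).1, fun x => (hf x).2, fun x hx => hf0 hx, ?_⟩
    have h2 : q < η.real F := by
      rwa [ENNReal.ofReal_lt_iff_lt_toReal h (measure_ne_top _ _)] at hqF
    refine h2.trans_le ?_
    rw [← integral_indicator_one hF.measurableSet]
    refine integral_mono ((integrable_const (1 : ℝ)).indicator hF.measurableSet)
      (f.continuous.integrable_of_hasCompactSupport (HasCompactSupport.of_compactSpace _))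
      fun x => ?_
    by_cases hx : x ∈ F
    · simp [hx, hf1 hx]
    · simpa [hx] using (hf x).1
  -- Approximating `f - 2ε` within `ε / 2` puts the polynomial, divided by `D`, between `f - 5ε/2`
  -- and `f - ε`. The upper bound gives both strict inequalities; the lower one loses less than the
  -- gap `3ε` in the integral.
  set ε := (∫ x, f x ∂η - q) / 3 with hε
  have hε0 : 0 < ε := by rw [hε]; linarith
  obtain ⟨P, Q, D, hD, h⟩ := exists_cubePoly_approx (f - ContinuousMap.const _ (2 * ε))
    (half_pos hε0)
  have hD' : (0 : ℝ) < D := by exact_mod_cast hD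
  have hlo : ∀ x, (f x - 5 / 2 * ε) * D < cubePoly P x - cubePoly Q x := fun x => by
    rw [← lt_div_iff₀ hD']
    have := (abs_lt.1 (h x)).2
    simp at this
    linarith
  have hhi : ∀ x, cubePoly P x - cubePoly Q x < (f x - ε) * D := fun x => by
    rw [← div_lt_iff₀ hD']
    have := (abs_lt.1 (h x)).1
    simp at this
    linarith
  refine ⟨P, Q, D, fun x => (hhi x).trans ?_, fun x hx => (hhi x).trans ?_, ?_⟩
  · nlinarith [hf1 x]
  · rw [hfU x hx]
    nlinarith
  · have hfi : Integrable f η :=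
      f.continuous.integrable_of_hasCompactSupport (HasCompactSupport.of_compactSpace _)
    have h1 : ∫ x, (f x - 5 / 2 * ε) * D ∂η ≤ ∫ x, (cubePoly P x - cubePoly Q x) ∂η :=
      integral_mono ((hfi.sub (integrable_const _)).mul_const _)
        ((integrable_cubePoly η P).sub (integrable_cubePoly η Q)) fun x => (hlo x).le
    refine lt_of_lt_of_le ?_ h1
    rw [integral_mul_const, integral_sub hfi (integrable_const _)]
    simp only [integral_const, probReal_univ, one_smul]
    refine mul_lt_mul_of_pos_right ?_ hD'
    linarith

/-! ### Grids of rational boxes -/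

/-- The lower corner of the cell with number `m` of the grid of `(N + 1) ^ k` cells in the first `k`
coordinates. -/
def cellLow (k N m i : ℕ) : ℚ :=
  if i < k then ((m / (N + 1) ^ i % (N + 1) : ℕ) : ℚ) / ((N : ℚ) + 1) else 0

/-- The upper corner of the cell with number `m` of the grid of `(N + 1) ^ k` cells in the first `k`
coordinates. -/
def cellHigh (k N m i : ℕ) : ℚ :=
  if i < k then ((m / (N + 1) ^ i % (N + 1) + 1 : ℕ) : ℚ) / ((N : ℚ) + 1) else 1

theorem exists_digits (b : ℕ) (k : ℕ) (d : ℕ → ℕ) (hd : ∀ i, d i < b) :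
    ∃ m < b ^ k, ∀ i < k, m / b ^ i % b = d i := by
  induction k generalizing d with
  | zero => exact ⟨0, by simp, by simp⟩
  | succ k ih =>
    obtain ⟨m, hm, h⟩ := ih (fun i => d (i + 1)) fun i => hd _
    have hb : 0 < b := (Nat.zero_le _).trans_lt (hd 0)
    refine ⟨d 0 + b * m, ?_, fun i hi => ?_⟩
    · have h1 := hd 0
      have h2 : b * (m + 1) ≤ b * b ^ k := Nat.mul_le_mul_left b hm
      rw [pow_succ']
      linarith
    · rcases i with _ | i
      · simp [Nat.mod_eq_of_lt (hd 0)]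
      · rw [pow_succ', ← Nat.div_div_eq_div_mul, Nat.add_mul_div_left _ _ hb,
          Nat.div_eq_of_lt (hd 0), zero_add]
        exact h i (by omega)

theorem exists_cell (k N : ℕ) (x : ℕ → unitInterval) : ∃ m < (N + 1) ^ k,
    ∀ i, ((cellLow k N m i : ℚ) : ℝ) ≤ x i ∧ (x i : ℝ) ≤ (cellHigh k N m i : ℚ) := by
  have hN : (0 : ℝ) < (N : ℝ) + 1 := by positivity
  -- The minimum with `N` puts the coordinate value `1` into the last cell.
  obtain ⟨m, hm, h⟩ := exists_digits (N + 1) k (fun i => min ⌊(x i : ℝ) * (N + 1)⌋₊ N)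
    fun i => Nat.lt_succ_of_le (min_le_right _ _)
  refine ⟨m, hm, fun i => ?_⟩
  rw [cellLow, cellHigh]
  split_ifs with hi
  · rw [h i hi]
    push_cast
    have h0 : 0 ≤ (x i : ℝ) * (N + 1) := mul_nonneg (x i).2.1 hN.le
    rw [div_le_iff₀ hN, le_div_iff₀ hN]
    refine ⟨(min_le_left _ _).trans (Nat.floor_le h0), ?_⟩
    rcases min_choice (⌊(x i : ℝ) * (N + 1)⌋₊ : ℝ) N with h | h <;> rw [h]
    · exact (Nat.lt_floor_add_one _).le
    · nlinarith [(x i).2.2]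
  · exact_mod_cast (x i).2

/-- The upper bound for a polynomial on a box by evaluation at the corners. -/
def boxUpper (P Q : List (List ℕ)) (lo hi : ℕ → ℚ) : ℚ :=
  (P.map fun β => (β.map hi).prod).sum - (Q.map fun β => (β.map lo).prod).sum

/-- The box between the corners `lo` and `hi` is contained in the cylinder `σ`. -/
def BoxInCylinder (σ : List IntervalIndex) (lo hi : ℕ → ℚ) : Prop :=
  ∀ i < σ.length, (σ.getD i default).1.val < lo i ∧ hi i < (σ.getD i default).2.val

/-- On each cell of the grid, evaluation at the corners shows that the polynomial `P - Q` is below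
`D` times the indicator function of `B`. -/
def GridBelow (P Q : List (List ℕ)) (D k N : ℕ) (B : List (List IntervalIndex)) : Prop :=
  ∀ m < (N + 1) ^ k, boxUpper P Q (cellLow k N m) (cellHigh k N m) < D ∧
    (boxUpper P Q (cellLow k N m) (cellHigh k N m) < 0 ∨
      ∃ σ ∈ B, BoxInCylinder σ (cellLow k N m) (cellHigh k N m))

theorem prod_map_le_prod_map {f g : ℕ → ℝ} (hf : ∀ i, 0 ≤ f i) (hfg : ∀ i, f i ≤ g i)
    (β : List ℕ) : (β.map f).prod ≤ (β.map g).prod := by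
  induction β with
  | nil => simp
  | cons i β ih =>
    simp only [List.map_cons, List.prod_cons]
    refine mul_le_mul (hfg i) ih (List.prod_nonneg fun a ha => ?_) ((hf i).trans (hfg i))
    obtain ⟨j, -, rfl⟩ := List.mem_map.1 ha
    exact hf j

theorem cast_prod_map (f : ℕ → ℚ) (β : List ℕ) :
    (((β.map f).prod : ℚ) : ℝ) = (β.map fun i => (f i : ℝ)).prod := by
  induction β with
  | nil => simp
  | cons i β ih => simp [ih]

theorem cellLow_nonneg (k N m i : ℕ) : 0 ≤ cellLow k N m i := by
  rw [cellLow]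
  split_ifs
  · positivity
  · rfl

theorem cast_sum_map {ι : Type*} (f : ι → ℚ) (l : List ι) :
    (((l.map f).sum : ℚ) : ℝ) = (l.map fun i => (f i : ℝ)).sum := by
  induction l with
  | nil => simp
  | cons i β ih => simp [ih]

/-- Monomials are monotone on nonnegative vectors, so `P` is largest at the upper corner and `Q`
smallest at the lower one. -/
theorem le_boxUpper {P Q : List (List ℕ)} {lo hi : ℕ → ℚ} {x : ℕ → unitInterval}
    (hlo : ∀ i, 0 ≤ lo i) (hx : ∀ i, ((lo i : ℚ) : ℝ) ≤ x i ∧ (x i : ℝ) ≤ (hi i : ℚ)) :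
    cubePoly P x - cubePoly Q x ≤ (boxUpper P Q lo hi : ℚ) := by
  rw [boxUpper, Rat.cast_sub, cast_sum_map, cast_sum_map]
  refine sub_le_sub (List.sum_le_sum fun β _ => ?_) (List.sum_le_sum fun β _ => ?_)
  · rw [cast_prod_map]
    exact prod_map_le_prod_map (fun i => (x i).2.1) (fun i => (hx i).2) β
  · rw [cast_prod_map]
    exact prod_map_le_prod_map (fun i => by exact_mod_cast hlo i) (fun i => (hx i).1) β

/-- The cells cover the cube. A cell containing a point outside the union lies in none of its
cylinders, so the bound on that cell is negative. -/
theorem GridBelow.le_indicator {P Q : List (List ℕ)} {D k N : ℕ} {B : List (List IntervalIndex)}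
    (h : GridBelow P Q D k N B) (x : ℕ → unitInterval) :
    cubePoly P x - cubePoly Q x ≤ D * (cylinderUnion B).indicator 1 x := by
  obtain ⟨m, hm, hx⟩ := exists_cell k N x
  have hle := le_boxUpper (P := P) (Q := Q) (cellLow_nonneg k N m) hx
  obtain ⟨h1, h2⟩ := h m hm
  have h1' : ((boxUpper P Q (cellLow k N m) (cellHigh k N m) : ℚ) : ℝ) < D := by exact_mod_cast h1
  by_cases hxB : x ∈ cylinderUnion B
  · simpa [hxB] using hle.trans h1'.le
  · rcases h2 with h2 | ⟨σ, hσ, h2⟩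
    · have h2' : ((boxUpper P Q (cellLow k N m) (cellHigh k N m) : ℚ) : ℝ) < 0 := by
        exact_mod_cast h2
      simpa [hxB] using hle.trans h2'.le
    · refine absurd ⟨σ, hσ, mem_cylinderSet_iff.2 fun i hi => ?_⟩ hxB
      exact ⟨(Rat.cast_lt.2 (h2 i hi).1).trans_le (hx i).1,
        (hx i).2.trans_lt (Rat.cast_lt.2 (h2 i hi).2)⟩

theorem cellLow_le_one (k N m i : ℕ) : cellLow k N m i ≤ 1 := by
  rw [cellLow]
  split_ifs
  · rw [div_le_one (by positivity)]
    have := Nat.mod_lt (m / (N + 1) ^ i) (Nat.succ_pos N)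
    exact_mod_cast this.le
  · exact zero_le_one

theorem cellHigh_eq {k N m i : ℕ} (hi : i < k) :
    cellHigh k N m i = cellLow k N m i + 1 / ((N : ℚ) + 1) := by
  rw [cellLow, cellHigh, if_pos hi, if_pos hi]
  push_cast
  ring

open Filter Topology in
-- Compactness: if every grid failed, lower corners of failing cells would accumulate at some `x`.
-- Both corners converge to `x` coordinatewise, so the corner bounds converge to the value of the
-- polynomial at `x`. The cells along the subsequence eventually pass the test: they enter a
-- cylinder around `x` if `x` is in the union, and have a negative bound otherwise.
theorem exists_gridBelow {P Q : List (List ℕ)} {D : ℕ} {B : List (List IntervalIndex)}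
    (h1 : ∀ x, cubePoly P x - cubePoly Q x < D)
    (h0 : ∀ x ∉ cylinderUnion B, cubePoly P x - cubePoly Q x < 0) :
    ∃ k N, GridBelow P Q D k N B := by
  by_contra! hcon
  -- The diagonal `k = N` refines the mesh and the set of divided coordinates together.
  have hcon' := fun N => hcon N N
  simp only [GridBelow, not_forall] at hcon'
  choose m _ hm using hcon'
  let y : ℕ → ℕ → unitInterval := fun N i =>
    ⟨(cellLow N N (m N) i : ℚ), by exact_mod_cast cellLow_nonneg _ _ _ _,
      by exact_mod_cast cellLow_le_one _ _ _ _⟩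
  obtain ⟨x, φ, hφ, hx⟩ := CompactSpace.tendsto_subseq y
  have hlo : ∀ i, Tendsto (fun n => ((cellLow (φ n) (φ n) (m (φ n)) i : ℚ) : ℝ)) atTop
      (𝓝 (x i)) := fun i =>
    (continuous_subtype_val.tendsto _).comp (tendsto_pi_nhds.1 hx i)
  have hhi : ∀ i, Tendsto (fun n => ((cellHigh (φ n) (φ n) (m (φ n)) i : ℚ) : ℝ)) atTop
      (𝓝 (x i)) := fun i => by
    have h := (hlo i).add
      ((tendsto_one_div_add_atTop_nhds_zero_nat (𝕜 := ℝ)).comp hφ.tendsto_atTop)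
    rw [add_zero] at h
    refine h.congr' ?_
    -- Coordinate `i` is divided only once `φ n > i`.
    filter_upwards [hφ.tendsto_atTop.eventually_gt_atTop i] with n hn
    rw [cellHigh_eq hn]
    push_cast
    rfl
  have hmono : ∀ {f : ℕ → ℕ → ℚ}, (∀ i, Tendsto (fun n => ((f n i : ℚ) : ℝ)) atTop (𝓝 (x i))) →
      ∀ R : List (List ℕ), Tendsto
        (fun n => (((R.map fun β => (β.map (f n)).prod).sum : ℚ) : ℝ)) atTop
        (𝓝 (cubePoly R x)) := by
    intro f hf R
    simp only [cast_sum_map, cast_prod_map]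
    refine tendsto_list_sum _ fun β _ => ?_
    exact tendsto_list_prod _ fun i _ => hf i
  have hU : Tendsto (fun n => ((boxUpper P Q (cellLow (φ n) (φ n) (m (φ n)))
      (cellHigh (φ n) (φ n) (m (φ n))) : ℚ) : ℝ)) atTop (𝓝 (cubePoly P x - cubePoly Q x)) := by
    simp only [boxUpper, Rat.cast_sub]
    exact (hmono hhi P).sub (hmono hlo Q)
  have e1 := hU.eventually_lt_const (h1 x)
  have e2 : ∀ᶠ n in atTop, boxUpper P Q (cellLow (φ n) (φ n) (m (φ n)))
      (cellHigh (φ n) (φ n) (m (φ n))) < 0 ∨ ∃ σ ∈ B, BoxInCylinder σ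
        (cellLow (φ n) (φ n) (m (φ n))) (cellHigh (φ n) (φ n) (m (φ n))) := by
    by_cases hxB : x ∈ cylinderUnion B
    · obtain ⟨σ, hσ, hxσ⟩ := hxB
      rw [mem_cylinderSet_iff] at hxσ
      have : ∀ᶠ n in atTop, ∀ i ∈ Finset.range σ.length,
          (σ.getD i default).1.val < cellLow (φ n) (φ n) (m (φ n)) i ∧
            cellHigh (φ n) (φ n) (m (φ n)) i < (σ.getD i default).2.val := by
        rw [Filter.eventually_all_finset]
        intro i hi
        have hi' := hxσ i (Finset.mem_range.1 hi)
        filter_upwards [(hlo i).eventually_const_lt hi'.1, (hhi i).eventually_lt_const hi'.2]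
          with n h1 h2
        exact ⟨by exact_mod_cast h1, by exact_mod_cast h2⟩
      filter_upwards [this] with n hn
      exact .inr ⟨σ, hσ, fun i hi => hn i (Finset.mem_range.2 hi)⟩
    · filter_upwards [hU.eventually_lt_const (h0 x hxB)] with n hn
      exact .inl (by exact_mod_cast hn)
  obtain ⟨n, hn1, hn2⟩ := (e1.and e2).exists
  exact hm (φ n) ⟨by exact_mod_cast hn1, hn2⟩

/-! ### The distribution from the moments -/

/-- Witnesses for lower bounds of the distribution: intervals for the moments of two lists `P` and
`Q` of monomials, and the numbers `D`, `k` and `N`. -/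
abbrev DistWitness : Type :=
  (List (List ℕ × IntervalIndex) × List (List ℕ × IntervalIndex)) × ℕ × ℕ × ℕ

/-- The bounds on moments in `w` imply that the measure of the union `Bq.1` is above `Bq.2`. -/
def DistWitness.Proves (w : DistWitness) (Bq : List (List IntervalIndex) × RatIndex) : Prop :=
  Bq.2.val * w.2.1 < (w.1.1.map fun b => b.2.1.val).sum - (w.1.2.map fun b => b.2.2.val).sum ∧
    GridBelow (w.1.1.map Prod.fst) (w.1.2.map Prod.fst) w.2.1 w.2.2.1 w.2.2.2 Bq.1

/-! ### Primitive recursiveness of the check for the distribution -/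

section Primrec

variable {α : Type*} [Primcodable α]

theorem primrecRat_cellLow {k N m i : α → ℕ} (hk : Primrec k) (hN : Primrec N) (hm : Primrec m)
    (hi : Primrec i) : PrimrecRat fun a => cellLow (k a) (N a) (m a) (i a) :=
  .ite (Primrec.nat_lt.comp hi hk) (.div_succ (Primrec.nat_mod.comp (Primrec.nat_div.comp hm
    (Primrec.nat_pow.comp (Primrec.succ.comp hN) hi)) (Primrec.succ.comp hN)) hN)
    ((PrimrecRat.natCast (Primrec.const 0)).of_eq fun _ => Nat.cast_zero)

theorem primrecRat_cellHigh {k N m i : α → ℕ} (hk : Primrec k) (hN : Primrec N) (hm : Primrec m)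
    (hi : Primrec i) : PrimrecRat fun a => cellHigh (k a) (N a) (m a) (i a) :=
  .ite (Primrec.nat_lt.comp hi hk) (.div_succ (Primrec.succ.comp (Primrec.nat_mod.comp
    (Primrec.nat_div.comp hm (Primrec.nat_pow.comp (Primrec.succ.comp hN) hi))
    (Primrec.succ.comp hN))) hN)
    ((PrimrecRat.natCast (Primrec.const 1)).of_eq fun _ => Nat.cast_one)

theorem primrecRat_boxUpper {P Q : α → List (List ℕ)} {lo hi : α → ℕ → ℚ} (hP : Primrec P)
    (hQ : Primrec Q) (hlo : PrimrecRat fun x : α × ℕ => lo x.1 x.2)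
    (hhi : PrimrecRat fun x : α × ℕ => hi x.1 x.2) :
    PrimrecRat fun a => boxUpper (P a) (Q a) (lo a) (hi a) := by
  refine .sub (.list_sum hP ?_) (.list_sum hQ ?_)
  · exact .list_prod (f := fun x : α × List ℕ => hi x.1) Primrec.snd
      (hhi.comp ((Primrec.fst.comp Primrec.fst).pair Primrec.snd))
  · exact .list_prod (f := fun x : α × List ℕ => lo x.1) Primrec.snd
      (hlo.comp ((Primrec.fst.comp Primrec.fst).pair Primrec.snd))

theorem primrec_getD_default {σ : α → List IntervalIndex} {i : α → ℕ} (hσ : Primrec σ)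
    (hi : Primrec i) : Primrec fun a => (σ a).getD (i a) default :=
  (Primrec.list_getD default).comp hσ hi

theorem primrecPred_boxInCylinder {σ : α → List IntervalIndex} {lo hi : α → ℕ → ℚ}
    (hσ : Primrec σ) (hlo : PrimrecRat fun x : α × ℕ => lo x.1 x.2)
    (hhi : PrimrecRat fun x : α × ℕ => hi x.1 x.2) :
    PrimrecPred fun a => BoxInCylinder (σ a) (lo a) (hi a) := by
  have h := primrec_getD_default (hσ.comp Primrec.fst) (Primrec.snd (α := α) (β := ℕ))
  exact .forall_lt_of_primrec (Primrec.list_length.comp hσ)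
    (.and (PrimrecRat.lt (.val (Primrec.fst.comp h)) hlo) (PrimrecRat.lt hhi (.val (Primrec.snd.comp h))))

theorem primrecPred_gridBelow {P Q : α → List (List ℕ)} {D k N : α → ℕ}
    {B : α → List (List IntervalIndex)} (hP : Primrec P) (hQ : Primrec Q) (hD : Primrec D)
    (hk : Primrec k) (hN : Primrec N) (hB : Primrec B) :
    PrimrecPred fun a => GridBelow (P a) (Q a) (D a) (k a) (N a) (B a) := by
  have hlo : PrimrecRat fun x : (α × ℕ) × ℕ => cellLow (k x.1.1) (N x.1.1) x.1.2 x.2 :=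
    primrecRat_cellLow (hk.comp (Primrec.fst.comp Primrec.fst))
      (hN.comp (Primrec.fst.comp Primrec.fst)) (Primrec.snd.comp Primrec.fst) Primrec.snd
  have hhi : PrimrecRat fun x : (α × ℕ) × ℕ => cellHigh (k x.1.1) (N x.1.1) x.1.2 x.2 :=
    primrecRat_cellHigh (hk.comp (Primrec.fst.comp Primrec.fst))
      (hN.comp (Primrec.fst.comp Primrec.fst)) (Primrec.snd.comp Primrec.fst) Primrec.snd
  have hU : PrimrecRat fun x : α × ℕ => boxUpper (P x.1) (Q x.1)
      (cellLow (k x.1) (N x.1) x.2) (cellHigh (k x.1) (N x.1) x.2) :=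
    primrecRat_boxUpper (hP.comp Primrec.fst) (hQ.comp Primrec.fst) hlo hhi
  refine .forall_lt_of_primrec (Primrec.nat_pow.comp (Primrec.succ.comp hN) hk) (.and
    (PrimrecRat.lt hU (.natCast (hD.comp Primrec.fst))) (.or (PrimrecRat.lt hU
      ((PrimrecRat.natCast (Primrec.const 0)).of_eq fun _ => Nat.cast_zero))
      (.exists_mem_of_primrec (hB.comp Primrec.fst) ?_)))
  have hsh : Primrec fun y : ((α × ℕ) × List IntervalIndex) × ℕ => (y.1.1, y.2) :=
    (Primrec.fst.comp Primrec.fst).pair Primrec.snd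
  exact primrecPred_boxInCylinder (σ := fun y : (α × ℕ) × List IntervalIndex => y.2)
    (lo := fun y => cellLow (k y.1.1) (N y.1.1) y.1.2)
    (hi := fun y => cellHigh (k y.1.1) (N y.1.1) y.1.2) Primrec.snd (hlo.comp hsh) (hhi.comp hsh)

theorem DistWitness.primrecRel_proves : PrimrecRel DistWitness.Proves := by
  have w : Primrec (Prod.fst : DistWitness × (List (List IntervalIndex) × RatIndex) → _) :=
    Primrec.fst
  have hP := Primrec.fst.comp (Primrec.fst.comp w)
  have hQ := Primrec.snd.comp (Primrec.fst.comp w)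
  have hD := Primrec.fst.comp (Primrec.snd.comp w)
  have hk := Primrec.fst.comp (Primrec.snd.comp (Primrec.snd.comp w))
  have hN := Primrec.snd.comp (Primrec.snd.comp (Primrec.snd.comp w))
  have hB : Primrec (fun x : DistWitness × (List (List IntervalIndex) × RatIndex) => x.2.1) :=
    Primrec.fst.comp Primrec.snd
  refine .and (PrimrecRat.lt (.mul (.val (Primrec.snd.comp Primrec.snd)) (.natCast hD))
    (.sub (.list_sum hP (.val (Primrec.fst.comp (Primrec.snd.comp Primrec.snd))))
      (.list_sum hQ (.val (Primrec.snd.comp (Primrec.snd.comp Primrec.snd))))))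
    (primrecPred_gridBelow (Primrec.list_map hP (Primrec.fst.comp Primrec.snd).to₂)
      (Primrec.list_map hQ (Primrec.fst.comp Primrec.snd).to₂) hD hk hN hB)

end Primrec

/-! ### Correctness of the witnesses for the distribution -/

theorem mixedMoment_eq_integral {Ω : Type*} [MeasurableSpace Ω] {P : Measure Ω}
    {x : Ω → ℕ → unitInterval} {η : Measure (ℕ → unitInterval)} (h : HasLaw x η P) (β : List ℕ) :
    mixedMoment P x β = ∫ y, cubeMonomial β y ∂η :=
  h.integral_comp (f := cubeMonomial β) (continuous_cubeMonomial β).aestronglyMeasurable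

theorem exists_ratIndex_btwn {a b : ℝ} (h : a < b) :
    ∃ r : RatIndex, a < (r.val : ℚ) ∧ ((r.val : ℚ) : ℝ) < b := by
  obtain ⟨q, hq⟩ := exists_rat_btwn h
  obtain ⟨r, rfl⟩ := RatIndex.val_surjective q
  exact ⟨r, hq⟩

theorem sum_map_le_add_length {ι : Type*} {f g : ι → ℝ} {δ : ℝ} (l : List ι)
    (h : ∀ i, f i ≤ g i + δ) : (l.map f).sum ≤ (l.map g).sum + l.length * δ := by
  induction l with
  | nil => simp
  | cons i l ih =>
    simp only [List.map_cons, List.sum_cons, List.length_cons]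
    push_cast
    linarith [h i]

theorem mem_distRep_iff {Ω : Type*} [MeasurableSpace Ω] {P : Measure Ω} [IsProbabilityMeasure P]
    {x : Ω → ℕ → unitInterval} {η : Measure (ℕ → unitInterval)} (h : HasLaw x η P)
    (Bq : List (List IntervalIndex) × RatIndex) :
    Bq ∈ distRep η ↔ ∃ w : DistWitness, w.Proves Bq ∧ ∀ b ∈ w.1.1 ++ w.1.2, b ∈ momentRep P x := by
  have : IsProbabilityMeasure η := h.isProbabilityMeasure_iff.1 inferInstance
  obtain ⟨B, q⟩ := Bq
  have hrep : ∀ b : List ℕ × IntervalIndex, b ∈ momentRep P x ↔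
      ((b.2.1.val : ℚ) : ℝ) < ∫ y, cubeMonomial b.1 y ∂η ∧
        ∫ y, cubeMonomial b.1 y ∂η < (b.2.2.val : ℚ) := by
    intro b
    rw [← mixedMoment_eq_integral h]
    rfl
  have hint : ∀ R S : List (List ℕ), ∫ y, (cubePoly R y - cubePoly S y) ∂η =
      (R.map fun β => ∫ y, cubeMonomial β y ∂η).sum -
        (S.map fun β => ∫ y, cubeMonomial β y ∂η).sum := by
    intro R S
    rw [integral_sub (integrable_cubePoly η R) (integrable_cubePoly η S), integral_cubePoly,
      integral_cubePoly]
  have hBm : MeasurableSet (cylinderUnion B) := (isOpen_cylinderUnion B).measurableSet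
  simp only [hrep]
  constructor
  · intro hq
    obtain ⟨R, S, D, h1, h0, hqD⟩ := exists_cubePoly_lt_indicator η (isOpen_cylinderUnion B) hq
    obtain ⟨k, N, hgrid⟩ := exists_gridBelow h1 h0
    rw [hint] at hqD
    set A := (R.map fun β => ∫ y, cubeMonomial β y ∂η).sum
    set C := (S.map fun β => ∫ y, cubeMonomial β y ∂η).sum
    -- The slack in the strict inequality is shared among the monomials; `+ 1` keeps the divisor
    -- positive when both lists are empty.
    obtain ⟨δ, hδ, hδ'⟩ : ∃ δ : ℝ, 0 < δ ∧
        ((R.length : ℝ) + S.length) * δ < A - C - (q.val : ℚ) * D := by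
      refine ⟨(A - C - (q.val : ℚ) * D) / (R.length + S.length + 1),
        div_pos (sub_pos.2 hqD) (by positivity), ?_⟩
      rw [mul_div_assoc', div_lt_iff₀ (by positivity)]
      linarith
    choose lo hlo using fun β => exists_ratIndex_btwn
      (sub_lt_self (∫ y, cubeMonomial β y ∂η) hδ)
    choose hi hhi using fun β => exists_ratIndex_btwn
      (lt_add_of_pos_right (∫ y, cubeMonomial β y ∂η) hδ)
    let e : List ℕ → List ℕ × IntervalIndex := fun β => (β, lo β, hi β)
    refine ⟨((R.map e, S.map e), D, k, N), ⟨?_, ?_⟩, ?_⟩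
    · have b1 := sum_map_le_add_length (f := fun β => ∫ y, cubeMonomial β y ∂η)
        (g := fun β => ((lo β).val : ℝ)) (δ := δ) R fun β => by linarith [(hlo β).1]
      have b2 := sum_map_le_add_length (g := fun β => ∫ y, cubeMonomial β y ∂η)
        (f := fun β => ((hi β).val : ℝ)) (δ := δ) S fun β => by linarith [(hhi β).2]
      simp only [List.map_map, Function.comp_def, e]
      rw [← Rat.cast_lt (K := ℝ), Rat.cast_sub, cast_sum_map, cast_sum_map]
      push_cast
      linarith
    · simpa [Function.comp_def, e] using hgrid
    · intro b hb
      obtain ⟨β, rfl⟩ : ∃ β, e β = b := by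
        rcases List.mem_append.1 hb with hb | hb <;> obtain ⟨β, -, h⟩ := List.mem_map.1 hb <;>
        exact ⟨β, h⟩
      exact ⟨(hlo β).2, (hhi β).1⟩
  · rintro ⟨⟨⟨LP, LQ⟩, D, k, N⟩, ⟨hq, hgrid⟩, hmem⟩
    simp only at hq hgrid hmem
    have hle : ∫ y, (cubePoly (LP.map Prod.fst) y - cubePoly (LQ.map Prod.fst) y) ∂η ≤
        D * η.real (cylinderUnion B) := by
      rw [← integral_indicator_one hBm, ← integral_const_mul]
      exact integral_mono ((integrable_cubePoly η _).sub (integrable_cubePoly η _))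
        (((integrable_const (1 : ℝ)).indicator hBm).const_mul _) hgrid.le_indicator
    rw [hint, List.map_map, List.map_map] at hle
    rw [← Rat.cast_lt (K := ℝ), Rat.cast_sub, cast_sum_map, cast_sum_map] at hq
    push_cast at hq
    have b1 : (LP.map fun b => ((b.2.1.val : ℚ) : ℝ)).sum ≤
        (LP.map ((fun β => ∫ y, cubeMonomial β y ∂η) ∘ Prod.fst)).sum :=
      List.sum_le_sum fun b hb => (hmem b (List.mem_append_left _ hb)).1.le
    have b2 : (LQ.map ((fun β => ∫ y, cubeMonomial β y ∂η) ∘ Prod.fst)).sum ≤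
        (LQ.map fun b => ((b.2.2.val : ℚ) : ℝ)).sum :=
      List.sum_le_sum fun b hb => (hmem b (List.mem_append_right _ hb)).2.le
    -- Strictness rules out `D = 0`.
    have hlt : ((q.val : ℚ) : ℝ) * D < η.real (cylinderUnion B) * D := by linarith
    exact lt_of_mul_lt_mul_right hlt (Nat.cast_nonneg D)

/-- The witnesses and their check do not depend on `P`, `x` or `η`, so one program serves all random
vectors. -/
theorem exists_computesFrom_momentRep : ∃ c : OracleCode, ∀ (Ω : Type u) [MeasurableSpace Ω]
    (P : Measure Ω) [IsProbabilityMeasure P] (x : Ω → ℕ → unitInterval)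
    (η : Measure (ℕ → unitInterval)), HasLaw x η P →
      c.ComputesFrom (distRep η) (momentRep P x) := by
  obtain ⟨c, hc⟩ := OracleCode.exists_computesFrom DistWitness.primrecRel_proves
    (need := fun w : DistWitness => w.1.1 ++ w.1.2) (Primrec.list_append.comp
      (Primrec.fst.comp Primrec.fst) (Primrec.snd.comp Primrec.fst))
  exact ⟨c, fun Ω _ P _ x η h => hc _ _ (mem_distRep_iff h)⟩

/-! ### Lower bounds for integrals by layers -/

/-- The elements of the `j`-th union of cylinders in `L` are cylinders `σ` with
`j + 1 ≤ n * b σ`, where `n` is the length of `L` and `b σ` a lower bound for a function on `σ`. -/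
def LayersBelow (b : List IntervalIndex → ℚ)
    (L : List (List (List IntervalIndex) × RatIndex)) : Prop :=
  ∀ j < L.length, ∀ σ ∈ (L.getD j default).1, (j : ℚ) + 1 ≤ L.length * b σ

theorem sum_map_eq_sum_range {ι : Type*} (g : ι → ℝ) (d : ι) (l : List ι) :
    (l.map g).sum = ∑ j ∈ Finset.range l.length, g (l.getD j d) := by
  induction l with
  | nil => simp
  | cons a l ih => simp [Finset.sum_range_succ', ih, add_comm]

/-- If `j` is the last layer containing `x`, at most `j + 1 ≤ y` layers contain it. -/
theorem sum_range_indicator_le {X : Type*} {V : ℕ → Set X} {x : X} {y : ℝ} (hy : 0 ≤ y) (n : ℕ)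
    (h : ∀ j < n, x ∈ V j → (j : ℝ) + 1 ≤ y) :
    ∑ j ∈ Finset.range n, (V j).indicator (1 : X → ℝ) x ≤ y := by
  have hle : ∀ n : ℕ, ∑ j ∈ Finset.range n, (V j).indicator (1 : X → ℝ) x ≤ n := fun n => by
    refine (Finset.sum_le_card_nsmul _ _ 1 fun j _ => ?_).trans (by simp)
    by_cases hx : x ∈ V j <;> simp [hx]
  induction n with
  | zero => simpa using hy
  | succ n ih =>
    by_cases hx : x ∈ V n
    · refine (hle (n + 1)).trans ?_
      push_cast
      exact h n n.lt_succ_self hx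
    · rw [Finset.sum_range_succ, Set.indicator_of_notMem hx, add_zero]
      exact ih fun j hj => h j (hj.trans n.lt_succ_self)

/-- All `j < n` with `j < y - 1` are counted, and there are at least `min (y - 1) n` of them. -/
theorem min_le_sum_range_indicator {X : Type*} {V : ℕ → Set X} {x : X} {y : ℝ} (n : ℕ)
    (h : ∀ j < n, (j : ℝ) + 1 < y → x ∈ V j) :
    min (y - 1) n ≤ ∑ j ∈ Finset.range n, (V j).indicator (1 : X → ℝ) x := by
  induction n with
  | zero => simp
  | succ n ih =>
    have ih := ih fun j hj => h j (hj.trans n.lt_succ_self)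
    rw [Finset.sum_range_succ]
    push_cast
    rcases lt_or_ge ((n : ℝ) + 1) y with hy | hy
    · rw [Set.indicator_of_mem (h n n.lt_succ_self hy), Pi.one_apply]
      rw [min_eq_right (by linarith)] at ih
      exact (min_le_right _ _).trans (by linarith)
    · have h0 : (0 : ℝ) ≤ (V n).indicator (1 : X → ℝ) x := by
        by_cases hx : x ∈ V n <;> simp [hx]
      rw [min_eq_left (by linarith)] at ih ⊢
      linarith

/-- Continuity of the measure along the directed family of finite subsets of `S`, which is countable
because cylinders have countably many indices. -/
theorem exists_lt_measureReal_cylinderUnion (η : Measure (ℕ → unitInterval)) [IsFiniteMeasure η]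
    (S : Set (List IntervalIndex)) {c : ℝ} (hc : c < η.real (⋃ σ ∈ S, cylinderSet σ)) :
    ∃ B : List (List IntervalIndex), (∀ σ ∈ B, σ ∈ S) ∧ c < η.real (cylinderUnion B) := by
  rcases lt_or_ge c 0 with h | h
  · exact ⟨[], by simp, h.trans_le measureReal_nonneg⟩
  have h1 : ENNReal.ofReal c < η (⋃ s : Finset S, cylinderUnion (s.toList.map Subtype.val)) := by
    have e : (⋃ s : Finset S, cylinderUnion (s.toList.map Subtype.val)) =
        ⋃ σ ∈ S, cylinderSet σ := by
      ext x
      simp only [Set.mem_iUnion, cylinderUnion, Set.mem_ofPred_eq, List.mem_map,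
        Finset.mem_toList]
      constructor
      · rintro ⟨s, _, ⟨σ, -, rfl⟩, hx⟩
        exact ⟨σ, σ.2, hx⟩
      · rintro ⟨σ, hσ, hx⟩
        exact ⟨{⟨σ, hσ⟩}, σ, ⟨⟨σ, hσ⟩, by simp, rfl⟩, hx⟩
    rwa [e, ENNReal.ofReal_lt_iff_lt_toReal h (measure_ne_top _ _)]
  rw [Directed.measure_iUnion, lt_iSup_iff] at h1
  · obtain ⟨s, hs⟩ := h1
    refine ⟨s.toList.map Subtype.val, fun σ hσ => ?_, ?_⟩
    · obtain ⟨τ, -, rfl⟩ := List.mem_map.1 hσ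
      exact τ.2
    · rwa [ENNReal.ofReal_lt_iff_lt_toReal h (measure_ne_top _ _)] at hs
  · refine Monotone.directed_le fun s t hst x => ?_
    rintro ⟨σ, hσ, hx⟩
    obtain ⟨τ, hτ, rfl⟩ := List.mem_map.1 hσ
    exact ⟨τ, List.mem_map.2 ⟨τ, Finset.mem_toList.2 (hst (Finset.mem_toList.1 hτ)), rfl⟩, hx⟩

/-- A rational lower bound for the integral of a function `f` with values in `[0,1]` follows from
finitely many facts about the distribution. -/
theorem lt_integral_iff_exists_layersBelow (η : Measure (ℕ → unitInterval))
    [IsProbabilityMeasure η] {f : (ℕ → unitInterval) → ℝ} (hf : Continuous f)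
    (hf0 : ∀ x, 0 ≤ f x) (hf1 : ∀ x, f x ≤ 1) {b : List IntervalIndex → ℚ}
    (hb : ∀ σ, ∀ x ∈ cylinderSet σ, ((b σ : ℚ) : ℝ) ≤ f x)
    (hb' : ∀ x, ∀ t < f x, ∃ σ, x ∈ cylinderSet σ ∧ t < (b σ : ℚ)) (r : ℚ) :
    (r : ℝ) < ∫ x, f x ∂η ↔ ∃ L : List (List (List IntervalIndex) × RatIndex),
      (r * L.length < (L.map fun Bq => Bq.2.val).sum ∧ LayersBelow b L) ∧
        ∀ Bq ∈ L, Bq ∈ distRep η := by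
  have hfi : Integrable f η :=
    hf.integrable_of_hasCompactSupport (HasCompactSupport.of_compactSpace _)
  have hind : ∀ {V : Set (ℕ → unitInterval)}, MeasurableSet V →
      Integrable (V.indicator (1 : (ℕ → unitInterval) → ℝ)) η :=
    fun hV => (integrable_const (1 : ℝ)).indicator hV
  constructor
  · intro hr
    -- Of the total gap `2nδ`, `nδ` pays for replacing the `n` layers by finite unions with rational
    -- bounds. The rest exceeds `1`, the loss from cutting `n * f` into unit layers.
    set δ := ((∫ x, f x ∂η) - r) / 2 with hδ
    have hδ0 : 0 < δ := by rw [hδ]; linarith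
    obtain ⟨n, hn⟩ := exists_nat_gt (1 / δ)
    have hn0 : (0 : ℝ) < n := (one_div_pos.2 hδ0).trans hn
    rw [div_lt_iff₀ hδ0] at hn
    -- By `hb'` the union `U j` of these cylinders contains `{f > (j + 1) / n}`.
    let S : ℕ → Set (List IntervalIndex) := fun j => {σ | (j : ℚ) + 1 ≤ n * b σ}
    let U : ℕ → Set (ℕ → unitInterval) := fun j => ⋃ σ ∈ S j, cylinderSet σ
    have hU : ∀ j, MeasurableSet (U j) := fun j =>
      (isOpen_biUnion fun σ _ => isOpen_cylinderSet σ).measurableSet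
    choose B hBS hB using fun j =>
      exists_lt_measureReal_cylinderUnion η (S j) (sub_lt_self (η.real (U j)) hδ0)
    choose q hq1 hq2 using fun j => exists_ratIndex_btwn (hB j)
    have hsum : n * ∫ x, f x ∂η - 1 ≤ ∑ j ∈ Finset.range n, η.real (U j) := by
      have e : ∑ j ∈ Finset.range n, η.real (U j) =
          ∫ x, ∑ j ∈ Finset.range n, (U j).indicator (1 : (ℕ → unitInterval) → ℝ) x ∂η := by
        rw [integral_finsetSum _ fun j _ => hind (hU j)]
        exact Finset.sum_congr rfl fun j _ => (integral_indicator_one (hU j)).symm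
      have e' : n * ∫ x, f x ∂η - 1 = ∫ x, (n * f x - 1) ∂η := by
        rw [integral_sub (hfi.const_mul _) (integrable_const _), integral_const_mul]
        simp
      rw [e, e']
      refine integral_mono ((hfi.const_mul _).sub (integrable_const _))
        (integrable_finsetSum _ fun j _ => hind (hU j)) fun x => ?_
      have h := min_le_sum_range_indicator (V := U) (x := x) (y := n * f x) n fun j _ hj => by
        obtain ⟨σ, hxσ, hσ⟩ := hb' x (((j : ℝ) + 1) / n) ((div_lt_iff₀' hn0).2 hj)
        rw [div_lt_iff₀' hn0] at hσ
        refine Set.mem_biUnion (show σ ∈ S j from ?_) hxσ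
        have : (j : ℚ) + 1 < n * b σ := by exact_mod_cast hσ
        exact this.le
      rwa [min_eq_left (by nlinarith [hf1 x])] at h
    refine ⟨(List.range n).map fun j => (B j, q j), ⟨?_, ?_⟩, ?_⟩
    · have h1 : ∑ j ∈ Finset.range n, (η.real (U j) - δ) ≤
          ∑ j ∈ Finset.range n, (((q j).val : ℚ) : ℝ) :=
        Finset.sum_le_sum fun j _ => (hq1 j).le
      rw [Finset.sum_sub_distrib, Finset.sum_const, Finset.card_range, nsmul_eq_mul] at h1
      rw [List.map_map, List.length_map, List.length_range, ← Rat.cast_lt (K := ℝ), cast_sum_map]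
      have e : ((List.range n).map fun j => (((((fun Bq : List (List IntervalIndex) × RatIndex =>
          Bq.2.val) ∘ fun j => (B j, q j)) j : ℚ)) : ℝ)).sum =
          ∑ j ∈ Finset.range n, (((q j).val : ℚ) : ℝ) := by
        rw [sum_map_eq_sum_range _ 0, List.length_range]
        refine Finset.sum_congr rfl fun j hj => ?_
        rw [List.getD_eq_getElem _ _ (by simpa using hj), List.getElem_range]
        rfl
      rw [e]
      push_cast
      have e2 : n * (∫ x, f x ∂η) = n * (2 * δ) + r * n := by rw [hδ]; ring
      linarith
    · intro j hj σ hσ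
      rw [List.length_map, List.length_range] at hj ⊢
      rw [List.getD_eq_getElem _ _ (by simpa using hj), List.getElem_map,
        List.getElem_range] at hσ
      exact hBS j σ hσ
    · intro Bq h
      obtain ⟨j, -, rfl⟩ := List.mem_map.1 h
      exact hq2 j
  · rintro ⟨L, ⟨hr, hL⟩, hmem⟩
    rw [← Rat.cast_lt (K := ℝ), cast_sum_map] at hr
    push_cast at hr
    have h1 : (L.map fun Bq => ((Bq.2.val : ℚ) : ℝ)).sum ≤
        (L.map fun Bq => η.real (cylinderUnion Bq.1)).sum :=
      List.sum_le_sum fun Bq h => (hmem Bq h).le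
    rw [sum_map_eq_sum_range (fun Bq : List (List IntervalIndex) × RatIndex =>
      η.real (cylinderUnion Bq.1)) default] at h1
    have hV : ∀ j, MeasurableSet (cylinderUnion (L.getD j default).1) := fun j =>
      (isOpen_cylinderUnion _).measurableSet
    have h2 : ∑ j ∈ Finset.range L.length, η.real (cylinderUnion (L.getD j default).1) ≤
        L.length * ∫ x, f x ∂η := by
      have e : ∑ j ∈ Finset.range L.length, η.real (cylinderUnion (L.getD j default).1) =
          ∫ x, ∑ j ∈ Finset.range L.length, (cylinderUnion (L.getD j default).1).indicator
            (1 : (ℕ → unitInterval) → ℝ) x ∂η := by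
        rw [integral_finsetSum _ fun j _ => hind (hV j)]
        exact Finset.sum_congr rfl fun j _ => (integral_indicator_one (hV j)).symm
      rw [e, ← integral_const_mul]
      refine integral_mono (integrable_finsetSum _ fun j _ => hind (hV j)) (hfi.const_mul _)
        fun x => ?_
      refine sum_range_indicator_le (V := fun j => cylinderUnion (L.getD j default).1)
        (mul_nonneg (Nat.cast_nonneg _) (hf0 x)) _ fun j hj hx => ?_
      obtain ⟨σ, hσ, hx⟩ := hx
      have h3 : ((j : ℝ) + 1) ≤ L.length * ((b σ : ℚ) : ℝ) := by exact_mod_cast hL j hj σ hσ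
      exact h3.trans (mul_le_mul_of_nonneg_left (hb σ x hx) (Nat.cast_nonneg _))
    have h3 : (r : ℝ) * L.length < (∫ x, f x ∂η) * L.length := by linarith
    exact lt_of_mul_lt_mul_right h3 (Nat.cast_nonneg _)

/-! ### The moments from the distribution -/

/-- An index for the interval `(0, 1)`. -/
def unitIntervalIndex : IntervalIndex := (((0, 0), 0), ((1, 0), 0))

/-- A lower bound for the `i`-th coordinate on a cylinder. -/
def cylinderLow (σ : List IntervalIndex) (i : ℕ) : ℚ :=
  max (σ.getD i unitIntervalIndex).1.val 0

/-- An upper bound for the `i`-th coordinate on a cylinder. -/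
def cylinderHigh (σ : List IntervalIndex) (i : ℕ) : ℚ :=
  min (σ.getD i unitIntervalIndex).2.val 1

theorem cylinderLow_le_and_le_cylinderHigh {σ : List IntervalIndex} {x : ℕ → unitInterval}
    (hx : x ∈ cylinderSet σ) (i : ℕ) :
    ((cylinderLow σ i : ℚ) : ℝ) ≤ x i ∧ (x i : ℝ) ≤ (cylinderHigh σ i : ℚ) := by
  have h01 := (x i).2
  rw [cylinderLow, cylinderHigh, Rat.cast_max, Rat.cast_min, Rat.cast_zero, Rat.cast_one,
    max_le_iff, le_min_iff]
  rcases lt_or_ge i σ.length with hi | hi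
  · have h := mem_cylinderSet_iff.1 hx i hi
    rw [List.getD_eq_getElem _ _ hi] at h ⊢
    exact ⟨⟨h.1.le, h01.1⟩, h.2.le, h01.2⟩
  -- A cylinder does not restrict coordinates past its length; the default interval supplies the
  -- bounds `0` and `1`.
  · rw [List.getD_eq_default _ _ hi]
    have e0 : RatIndex.val unitIntervalIndex.1 = 0 := by simp [unitIntervalIndex, RatIndex.val]
    have e1 : RatIndex.val unitIntervalIndex.2 = 1 := by simp [unitIntervalIndex, RatIndex.val]
    rw [e0, e1, Rat.cast_zero, Rat.cast_one]
    exact ⟨⟨h01.1, h01.1⟩, h01.2, h01.2⟩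

theorem cylinderLow_nonneg (σ : List IntervalIndex) (i : ℕ) : 0 ≤ cylinderLow σ i :=
  le_max_right _ _

open Filter Topology in
/-- Every point has arbitrarily small cylinders around it. -/
theorem exists_cylinders_tendsto (x : ℕ → unitInterval) (k : ℕ) :
    ∃ σ : ℕ → List IntervalIndex, (∀ n, x ∈ cylinderSet (σ n)) ∧ ∀ i < k,
      Tendsto (fun n => ((cylinderLow (σ n) i : ℚ) : ℝ)) atTop (𝓝 (x i)) ∧
      Tendsto (fun n => ((cylinderHigh (σ n) i : ℚ) : ℝ)) atTop (𝓝 (x i)) := by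
  have hpos : ∀ n : ℕ, (0 : ℝ) < 1 / ((n : ℝ) + 1) := fun n => by positivity
  choose lo hlo using fun n i => exists_ratIndex_btwn (sub_lt_self (x i : ℝ) (hpos n))
  choose hi hhi using fun n i => exists_ratIndex_btwn (lt_add_of_pos_right (x i : ℝ) (hpos n))
  let σ : ℕ → List IntervalIndex := fun n => (List.range k).map fun i => (lo n i, hi n i)
  have hσ : ∀ n d, ∀ i < k, (σ n).getD i d = (lo n i, hi n i) := fun n d i hik => by
    rw [List.getD_eq_getElem _ _ (by simpa [σ] using hik)]
    simp [σ]
  have hlen : ∀ n, (σ n).length = k := fun n => by simp [σ]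
  have h0 := tendsto_one_div_add_atTop_nhds_zero_nat (𝕜 := ℝ)
  refine ⟨σ, fun n => mem_cylinderSet_iff.2 fun i hik => ?_, fun i hik => ⟨?_, ?_⟩⟩
  · rw [hlen] at hik
    rw [hσ n _ i hik]
    exact ⟨(hlo n i).2, (hhi n i).1⟩
  · have h : Tendsto (fun n : ℕ => (x i : ℝ) - 1 / ((n : ℝ) + 1)) atTop (𝓝 (x i)) := by
      simpa using tendsto_const_nhds.sub h0
    refine tendsto_of_tendsto_of_tendsto_of_le_of_le h tendsto_const_nhds (fun n => ?_) fun n => ?_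
    · rw [cylinderLow, hσ n _ i hik, Rat.cast_max]
      exact (hlo n i).1.le.trans (le_max_left _ _)
    · rw [cylinderLow, hσ n _ i hik, Rat.cast_max, Rat.cast_zero]
      exact max_le (hlo n i).2.le (x i).2.1
  · have h : Tendsto (fun n : ℕ => (x i : ℝ) + 1 / ((n : ℝ) + 1)) atTop (𝓝 (x i)) := by
      simpa using tendsto_const_nhds.add h0
    refine tendsto_of_tendsto_of_tendsto_of_le_of_le tendsto_const_nhds h (fun n => ?_) fun n => ?_
    · rw [cylinderHigh, hσ n _ i hik, Rat.cast_min, Rat.cast_one]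
      exact le_min (hhi n i).1.le (x i).2.2
    · rw [cylinderHigh, hσ n _ i hik, Rat.cast_min]
      exact (min_le_left _ _).trans (hhi n i).2.le

theorem List.exists_forall_mem_lt (β : List ℕ) : ∃ k, ∀ i ∈ β, i < k :=
  ⟨β.sum + 1, fun _ hi => Nat.lt_succ_of_le (List.le_sum_of_mem hi)⟩

/-- On a cylinder the product of the lower bounds of the coordinates bounds the monomial from below,
and this bound approaches the value at a point as cylinders shrink to it. -/
theorem lt_integral_cubeMonomial_iff (η : Measure (ℕ → unitInterval)) [IsProbabilityMeasure η]
    (β : List ℕ) (r : ℚ) :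
    (r : ℝ) < ∫ x, cubeMonomial β x ∂η ↔ ∃ L : List (List (List IntervalIndex) × RatIndex),
      (r * L.length < (L.map fun Bq => Bq.2.val).sum ∧
        LayersBelow (fun σ => (β.map (cylinderLow σ)).prod) L) ∧ ∀ Bq ∈ L, Bq ∈ distRep η := by
  refine lt_integral_iff_exists_layersBelow η (continuous_cubeMonomial β) (cubeMonomial_nonneg β)
    (cubeMonomial_le_one β) (fun σ x hx => ?_) (fun x t ht => ?_) r
  · rw [cast_prod_map]
    exact prod_map_le_prod_map (fun i => by exact_mod_cast cylinderLow_nonneg σ i)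
      (fun i => (cylinderLow_le_and_le_cylinderHigh hx i).1) β
  · obtain ⟨k, hk⟩ := List.exists_forall_mem_lt β
    obtain ⟨σ, hxσ, hσ⟩ := exists_cylinders_tendsto x k
    have h := tendsto_list_prod β fun i hi => (hσ i (hk i hi)).1
    obtain ⟨n, hn⟩ := (h.eventually_const_lt ht).exists
    exact ⟨σ n, hxσ n, by rwa [cast_prod_map]⟩

/-- The distribution supplies only lower bounds, so the layers are taken for one minus the monomial.
-/
theorem integral_cubeMonomial_lt_iff (η : Measure (ℕ → unitInterval)) [IsProbabilityMeasure η]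
    (β : List ℕ) (r : ℚ) :
    ∫ x, cubeMonomial β x ∂η < r ↔ ∃ L : List (List (List IntervalIndex) × RatIndex),
      ((1 - r) * L.length < (L.map fun Bq => Bq.2.val).sum ∧
        LayersBelow (fun σ => 1 - (β.map (cylinderHigh σ)).prod) L) ∧
          ∀ Bq ∈ L, Bq ∈ distRep η := by
  rw [← lt_integral_iff_exists_layersBelow η (f := fun x => 1 - cubeMonomial β x)
    (continuous_const.sub (continuous_cubeMonomial β))
    (fun x => sub_nonneg.2 (cubeMonomial_le_one β x))
    (fun x => sub_le_self _ (cubeMonomial_nonneg β x)) (fun σ x hx => ?_) (fun x t ht => ?_) (1 - r)]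
  · rw [integral_sub (integrable_const _) (integrable_cubeMonomial η β)]
    simp
  · rw [Rat.cast_sub, cast_prod_map, Rat.cast_one]
    exact sub_le_sub_left (prod_map_le_prod_map (fun i => (x i).2.1)
      (fun i => (cylinderLow_le_and_le_cylinderHigh hx i).2) β) 1
  · obtain ⟨k, hk⟩ := List.exists_forall_mem_lt β
    obtain ⟨σ, hxσ, hσ⟩ := exists_cylinders_tendsto x k
    have h := (tendsto_list_prod β fun i hi => (hσ i (hk i hi)).2).const_sub 1
    obtain ⟨n, hn⟩ := (h.eventually_const_lt ht).exists
    exact ⟨σ n, hxσ n, by rwa [Rat.cast_sub, cast_prod_map, Rat.cast_one]⟩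

/-- Witnesses for a lower and an upper bound on a moment. -/
abbrev MomentWitness : Type :=
  List (List (List IntervalIndex) × RatIndex) × List (List (List IntervalIndex) × RatIndex)

/-- The bounds on the distribution in `w` imply that the interval `βI.2` contains the moment with
index `βI.1`. -/
def MomentWitness.Proves (w : MomentWitness) (βI : List ℕ × IntervalIndex) : Prop :=
  (βI.2.1.val * w.1.length < (w.1.map fun Bq => Bq.2.val).sum ∧
    LayersBelow (fun σ => (βI.1.map (cylinderLow σ)).prod) w.1) ∧
  ((1 - βI.2.2.val) * w.2.length < (w.2.map fun Bq => Bq.2.val).sum ∧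
    LayersBelow (fun σ => 1 - (βI.1.map (cylinderHigh σ)).prod) w.2)

/-! ### Primitive recursiveness of the check for the moments -/

section Primrec

variable {α : Type*} [Primcodable α]

theorem primrecPred_layersBelow {b : α → List IntervalIndex → ℚ}
    {L : α → List (List (List IntervalIndex) × RatIndex)} (hL : Primrec L)
    (hb : PrimrecRat fun x : α × List IntervalIndex => b x.1 x.2) :
    PrimrecPred fun a => LayersBelow (b a) (L a) := by
  refine .forall_lt_of_primrec (Primrec.list_length.comp hL) (.forall_mem_of_primrec
    (Primrec.fst.comp ((Primrec.list_getD default).comp (hL.comp Primrec.fst) Primrec.snd)) ?_)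
  exact PrimrecRat.le (.of_eq (.natCast (Primrec.succ.comp (Primrec.snd.comp Primrec.fst)))
    fun _ => Nat.cast_succ _)
    (.mul (.natCast (Primrec.list_length.comp (hL.comp (Primrec.fst.comp Primrec.fst))))
      (hb.comp ((Primrec.fst.comp Primrec.fst).pair Primrec.snd)))

theorem PrimrecRat.natCast_const (n : ℕ) : PrimrecRat fun _ : α => (n : ℚ) :=
  .natCast (Primrec.const n)

theorem primrecRat_cylinderLow {σ : α → List IntervalIndex} {i : α → ℕ} (hσ : Primrec σ)
    (hi : Primrec i) : PrimrecRat fun a => cylinderLow (σ a) (i a) :=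
  .max (.val (Primrec.fst.comp ((Primrec.list_getD _).comp hσ hi)))
    ((PrimrecRat.natCast_const 0).of_eq fun _ => Nat.cast_zero)

theorem primrecRat_cylinderHigh {σ : α → List IntervalIndex} {i : α → ℕ} (hσ : Primrec σ)
    (hi : Primrec i) : PrimrecRat fun a => cylinderHigh (σ a) (i a) :=
  .min (.val (Primrec.snd.comp ((Primrec.list_getD _).comp hσ hi)))
    ((PrimrecRat.natCast_const 1).of_eq fun _ => Nat.cast_one)

theorem primrecRat_prod_cylinderLow {β : α → List ℕ} {σ : α → List IntervalIndex}
    (hβ : Primrec β) (hσ : Primrec σ) :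
    PrimrecRat fun a => ((β a).map (cylinderLow (σ a))).prod :=
  .list_prod (f := fun a => cylinderLow (σ a)) hβ
    (primrecRat_cylinderLow (hσ.comp Primrec.fst) Primrec.snd)

theorem primrecRat_prod_cylinderHigh {β : α → List ℕ} {σ : α → List IntervalIndex}
    (hβ : Primrec β) (hσ : Primrec σ) :
    PrimrecRat fun a => ((β a).map (cylinderHigh (σ a))).prod :=
  .list_prod (f := fun a => cylinderHigh (σ a)) hβ
    (primrecRat_cylinderHigh (hσ.comp Primrec.fst) Primrec.snd)

theorem primrecPred_length_mul_lt_sum {r : α → ℚ}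
    {L : α → List (List (List IntervalIndex) × RatIndex)} (hr : PrimrecRat r) (hL : Primrec L) :
    PrimrecPred fun a => r a * (L a).length < ((L a).map fun Bq => Bq.2.val).sum :=
  PrimrecRat.lt (.mul hr (.natCast (Primrec.list_length.comp hL)))
    (.list_sum hL (.val (Primrec.snd.comp Primrec.snd)))

theorem MomentWitness.primrecRel_proves : PrimrecRel MomentWitness.Proves := by
  have hβ : Primrec fun x : MomentWitness × (List ℕ × IntervalIndex) => x.2.1 :=
    Primrec.fst.comp Primrec.snd
  have hlo : Primrec fun x : MomentWitness × (List ℕ × IntervalIndex) => x.2.2.1 :=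
    Primrec.fst.comp (Primrec.snd.comp Primrec.snd)
  have hhi : Primrec fun x : MomentWitness × (List ℕ × IntervalIndex) => x.2.2.2 :=
    Primrec.snd.comp (Primrec.snd.comp Primrec.snd)
  have h1 : Primrec fun x : MomentWitness × (List ℕ × IntervalIndex) => x.1.1 :=
    Primrec.fst.comp Primrec.fst
  have h2 : Primrec fun x : MomentWitness × (List ℕ × IntervalIndex) => x.1.2 :=
    Primrec.snd.comp Primrec.fst
  have one : PrimrecRat fun _ : MomentWitness × (List ℕ × IntervalIndex) => (1 : ℚ) :=
    (PrimrecRat.natCast_const 1).of_eq fun _ => Nat.cast_one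
  have one' : PrimrecRat fun _ : (MomentWitness × (List ℕ × IntervalIndex)) ×
      List IntervalIndex => (1 : ℚ) :=
    (PrimrecRat.natCast_const 1).of_eq fun _ => Nat.cast_one
  have hlow := primrecRat_prod_cylinderLow (hβ.comp Primrec.fst)
    (Primrec.snd (α := MomentWitness × (List ℕ × IntervalIndex)) (β := List IntervalIndex))
  have hhigh := primrecRat_prod_cylinderHigh (hβ.comp Primrec.fst)
    (Primrec.snd (α := MomentWitness × (List ℕ × IntervalIndex)) (β := List IntervalIndex))
  have e1 := primrecPred_length_mul_lt_sum (PrimrecRat.val hlo) h1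
  have e2 := primrecPred_length_mul_lt_sum (one.sub (PrimrecRat.val hhi)) h2
  have e3 := primrecPred_layersBelow
    (b := fun (x : MomentWitness × (List ℕ × IntervalIndex)) σ =>
      (x.2.1.map (cylinderLow σ)).prod) h1 hlow
  have e4 := primrecPred_layersBelow
    (b := fun (x : MomentWitness × (List ℕ × IntervalIndex)) σ =>
      1 - (x.2.1.map (cylinderHigh σ)).prod) h2 (one'.sub hhigh)
  exact (e1.and e3).and (e2.and e4)

end Primrec

/-! ### Correctness of the witnesses for the moments -/

theorem mem_momentRep_iff {Ω : Type*} [MeasurableSpace Ω] {P : Measure Ω} [IsProbabilityMeasure P]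
    {x : Ω → ℕ → unitInterval} {η : Measure (ℕ → unitInterval)} (h : HasLaw x η P)
    (βI : List ℕ × IntervalIndex) :
    βI ∈ momentRep P x ↔ ∃ w : MomentWitness, w.Proves βI ∧ ∀ b ∈ w.1 ++ w.2, b ∈ distRep η := by
  have : IsProbabilityMeasure η := h.isProbabilityMeasure_iff.1 inferInstance
  have e : βI ∈ momentRep P x ↔
      ((βI.2.1.val : ℚ) : ℝ) < ∫ y, cubeMonomial βI.1 y ∂η ∧
        ∫ y, cubeMonomial βI.1 y ∂η < (βI.2.2.val : ℚ) := by
    rw [← mixedMoment_eq_integral h]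
    rfl
  rw [e, lt_integral_cubeMonomial_iff, integral_cubeMonomial_lt_iff]
  constructor
  · rintro ⟨⟨L, hL, hL'⟩, M, hM, hM'⟩
    exact ⟨(L, M), ⟨hL, hM⟩, fun b hb => (List.mem_append.1 hb).elim (hL' b) (hM' b)⟩
  · rintro ⟨⟨L, M⟩, ⟨hL, hM⟩, h⟩
    exact ⟨⟨L, hL, fun b hb => h b (List.mem_append_left _ hb)⟩,
      M, hM, fun b hb => h b (List.mem_append_right _ hb)⟩

theorem exists_computesFrom_distRep : ∃ c : OracleCode, ∀ (Ω : Type u) [MeasurableSpace Ω]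
    (P : Measure Ω) [IsProbabilityMeasure P] (x : Ω → ℕ → unitInterval)
    (η : Measure (ℕ → unitInterval)), HasLaw x η P →
      c.ComputesFrom (momentRep P x) (distRep η) := by
  obtain ⟨c, hc⟩ := OracleCode.exists_computesFrom MomentWitness.primrecRel_proves
    (need := fun w : MomentWitness => w.1 ++ w.2) Primrec.list_append
  exact ⟨c, fun Ω _ P _ x η h => hc _ _ (mem_momentRep_iff h)⟩

theorem theorem4p2 :
    (∃ c : OracleCode, ∀ (Ω : Type u) [MeasurableSpace Ω] (P : Measure Ω) [IsProbabilityMeasure P]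
      (x : Ω → ℕ → unitInterval) (η : Measure (ℕ → unitInterval)), HasLaw x η P →
        c.ComputesFrom (distRep η) (momentRep P x)) ∧
    (∃ c : OracleCode, ∀ (Ω : Type u) [MeasurableSpace Ω] (P : Measure Ω) [IsProbabilityMeasure P]
      (x : Ω → ℕ → unitInterval) (η : Measure (ℕ → unitInterval)), HasLaw x η P →
        c.ComputesFrom (momentRep P x) (distRep η)) ∧
    (∀ (Ω : Type u) [MeasurableSpace Ω] (P : Measure Ω) [IsProbabilityMeasure P]
      (x : Ω → ℕ → unitInterval) (η : Measure (ℕ → unitInterval)), HasLaw x η P →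
        (ComputableDist η ↔ ComputableMoments P x)) := by
  refine ⟨exists_computesFrom_momentRep, exists_computesFrom_distRep,
    fun Ω _ P _ x η h => ⟨fun hd => ?_, fun hm => ?_⟩⟩
  -- Fed with a computable listing of the c.e. representation, the oracle program becomes an
  -- ordinary partial recursive function.
  · obtain ⟨c, hc⟩ := exists_computesFrom_distRep.{u}
    obtain ⟨p, hp, hl⟩ := exists_computable_isListing hd
    exact (hc Ω P x η h).rePred hp hl
  · obtain ⟨c, hc⟩ := exists_computesFrom_momentRep.{u}
    obtain ⟨p, hp, hl⟩ := exists_computable_isListing hm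
    exact (hc Ω P x η h).rePred hp hl
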